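/- Let $p$ be a prime and $M\ge 1$ an integer with $p\nmid M$, let $w\ge 2$ be even, and let $F$ be a field of characteristic $\ell$ with $\ell>w$ and $\ell\nmid 6pM$. Let $V=V_w(F)$ be the space of polynomials of degree at most $w$ with coefficients in $F$, on which matrices $\gamma=\begin{pmatrix}a&b\\c&d\end{pmatrix}\in \mathrm{SL}_2(\mathbb{Z}[1/p])$ act on the right, via the ring homomorphism $\mathbb{Z}[1/p]\to F$, by $$(P|\gamma)(X)=P\!\left(\frac{aX+b}{cX+d}\right)(cX+d)^w .$$ Put $\Gamma_0(M)'=\begin{pmatrix}p&0\\0&1\end{pmatrix}^{-1}\Gamma_0(M)\begin{pmatrix}p&0\\0&1\end{pmatrix}$, so that $\Gamma_0(M)\cap\Gamma_0(M)'=\Gamma_0(Mp)$, and consider the sum of the restriction maps in group cohomology $$\alpha: H^1(\Gamma_0(M),V)\oplus H^1(\Gamma_0(M)',V)\longrightarrow H^1(\Gamma_0(Mp),V).$$ If $\ell\ne w+3$, then $\alpha$ is injective. If $\ell=w+3$, then the kernel of $\alpha$ is one-dimensional over $F$. -/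

import Mathlib

open Polynomial
open scoped MatrixGroups

noncomputable section

namespace IharaFull

universe u

section PolynomialModule

variable {F : Type u} [CommRing F]

/-- `V_w(F)`: the polynomials of degree at most `w` with coefficients in `F`. -/
abbrev V (F : Type u) [CommRing F] (w : ℕ) : Submodule F F[X] := Polynomial.degreeLE F w

/-- Substitution of the fraction `A / B` for the variable, multiplied by `B ^ w`: for `P` of degree
at most `w` this is `P(A / B) * B ^ w = ∑ᵢ pᵢ A ^ i B ^ (w - i)`. -/
def substHom (w : ℕ) (A B : F[X]) : F[X] →ₗ[F] F[X] where
  toFun P := ∑ i ∈ Finset.range (w + 1), C (P.coeff i) * (A ^ i * B ^ (w - i))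
  map_add' P Q := by simp [add_mul, Finset.sum_add_distrib]
  map_smul' r P := by simp [Finset.mul_sum, mul_assoc, Polynomial.smul_eq_C_mul]

theorem substHom_apply (w : ℕ) (A B P : F[X]) :
    substHom w A B P = ∑ i ∈ Finset.range (w + 1), C (P.coeff i) * (A ^ i * B ^ (w - i)) := rfl

theorem mem_V_iff {w : ℕ} {P : F[X]} : P ∈ V F w ↔ P.natDegree ≤ w := by
  rw [V, Polynomial.mem_degreeLE, Polynomial.natDegree_le_iff_degree_le]

theorem substHom_eq_aeval (w : ℕ) (A B P : F[X]) :
    substHom w A B P = MvPolynomial.aeval ![A, B] (P.homogenize w) := by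
  rw [substHom_apply, Polynomial.homogenize, map_sum,
    Finset.Nat.sum_antidiagonal_eq_sum_range_succ_mk]
  refine Finset.sum_congr rfl fun i _ => ?_
  rw [MvPolynomial.aeval_monomial, Finsupp.prod_fintype _ _ (by simp)]
  simp [Fin.prod_univ_two, Finsupp.update_apply]

theorem substHom_mul {m n : ℕ} (A B : F[X]) {P Q : F[X]} (hP : P.natDegree ≤ m)
    (hQ : Q.natDegree ≤ n) :
    substHom (m + n) A B (P * Q) = substHom m A B P * substHom n A B Q := by
  simp only [substHom_eq_aeval, Polynomial.homogenize_mul P Q hP hQ, map_mul]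

theorem substHom_pow (A B : F[X]) {P : F[X]} (hP : P.natDegree ≤ 1) (n : ℕ) :
    substHom n A B (P ^ n) = substHom 1 A B P ^ n := by
  induction n with
  | zero => simp [substHom_apply]
  | succ n ih =>
    rw [pow_succ, substHom_mul A B ((natDegree_pow_le_of_le n hP).trans (by simp)) hP, ih, pow_succ]

theorem natDegree_linear_le (a b : F) : (C a * X + C b).natDegree ≤ 1 :=
  Polynomial.natDegree_linear_le

theorem substHom_linear (A B : F[X]) (a b : F) :
    substHom 1 A B (C a * X + C b) = C a * A + C b * B := by
  rw [substHom_apply, Finset.sum_range_succ, Finset.sum_range_one]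
  simp [add_comm]

/-- The right action of matrices on polynomials:
`(P | γ)(X) = P((a X + b) / (c X + d)) * (c X + d) ^ w` for `γ = (a b; c d)`. -/
def slash (w : ℕ) (γ : Matrix (Fin 2) (Fin 2) F) : F[X] →ₗ[F] F[X] :=
  substHom w (C (γ 0 0) * X + C (γ 0 1)) (C (γ 1 0) * X + C (γ 1 1))

theorem slash_apply (w : ℕ) (γ : Matrix (Fin 2) (Fin 2) F) (P : F[X]) :
    slash w γ P = ∑ i ∈ Finset.range (w + 1), C (P.coeff i) *
      ((C (γ 0 0) * X + C (γ 0 1)) ^ i * (C (γ 1 0) * X + C (γ 1 1)) ^ (w - i)) := rfl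

theorem slash_mem (w : ℕ) (γ : Matrix (Fin 2) (Fin 2) F) (P : F[X]) : slash w γ P ∈ V F w := by
  rw [slash, substHom_apply]
  refine Submodule.sum_mem _ fun i hi => mem_V_iff.2 ?_
  have hi' : i ≤ w := Nat.lt_succ_iff.1 (Finset.mem_range.1 hi)
  refine (natDegree_C_mul_le _ _).trans (natDegree_mul_le.trans ?_)
  have h1 := natDegree_pow_le_of_le i (natDegree_linear_le (γ 0 0) (γ 0 1))
  have h2 := natDegree_pow_le_of_le (w - i) (natDegree_linear_le (γ 1 0) (γ 1 1))
  omega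

theorem slash_one {w : ℕ} {P : F[X]} (hP : P ∈ V F w) : slash w 1 P = P := by
  rw [mem_V_iff] at hP
  conv_rhs => rw [P.as_sum_range_C_mul_X_pow' (Nat.lt_succ_of_le hP)]
  simp [slash, substHom_apply]

theorem slash_mul (w : ℕ) (γ δ : Matrix (Fin 2) (Fin 2) F) (P : F[X]) :
    slash w (γ * δ) P = slash w δ (slash w γ P) := by
  rw [slash_apply w (γ * δ) P, slash_apply w γ P, map_sum]
  refine Finset.sum_congr rfl fun i hi => ?_
  have hi' : i ≤ w := Nat.lt_succ_iff.1 (Finset.mem_range.1 hi)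
  obtain ⟨j, rfl⟩ := Nat.exists_eq_add_of_le hi'
  rw [← smul_eq_C_mul (P.coeff i), ← smul_eq_C_mul (P.coeff i), map_smul, Nat.add_sub_cancel_left,
    slash, substHom_mul _ _ ((natDegree_pow_le_of_le i (natDegree_linear_le _ _)).trans (by simp))
      ((natDegree_pow_le_of_le j (natDegree_linear_le _ _)).trans (by simp)),
    substHom_pow _ _ (natDegree_linear_le _ _), substHom_pow _ _ (natDegree_linear_le _ _),
    substHom_linear, substHom_linear]
  simp only [Matrix.mul_apply, Fin.sum_univ_two, map_add, map_mul]
  congr 3 <;> ring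

/-- `V_w(F)` as a representation of `GL₂(F)`. The right action `P ↦ P | γ` is turned into a left
action as usual, `γ • P = P | γ⁻¹`, so that the group cohomology is the same. -/
def polyRep (F : Type u) [CommRing F] (w : ℕ) : Representation F (GL (Fin 2) F) (V F w) where
  toFun γ := (slash w ((γ⁻¹ : GL (Fin 2) F) : Matrix (Fin 2) (Fin 2) F)).restrict
    fun P _ => slash_mem w _ P
  map_one' := by
    ext1 P
    exact Subtype.ext (by simpa [LinearMap.restrict_apply] using slash_one P.2)
  map_mul' γ δ := by
    ext1 P
    exact Subtype.ext (by simp [LinearMap.restrict_apply, slash_mul])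

end PolynomialModule

section Groups

/-- The ring `ℤ[1/p]`. -/
abbrev ZInv (p : ℕ) : Type := Localization.Away (p : ℤ)

theorem isUnit_natCast_ZInv (p : ℕ) : IsUnit ((p : ℕ) : ZInv p) := by
  simpa using IsLocalization.Away.algebraMap_isUnit (S := ZInv p) (p : ℤ)

/-- The matrix `(p 0; 0 1)` in `GL₂(ℤ[1/p])`. -/
def diagP (p : ℕ) : GL (Fin 2) (ZInv p) :=
  Matrix.GeneralLinearGroup.mk'' !![(p : ZInv p), 0; 0, 1]
    (by simpa [Matrix.det_fin_two] using isUnit_natCast_ZInv p)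

/-- `Γ₀(N)`, as a subgroup of `GL₂(ℤ[1/p])`. -/
def Gamma0 (p N : ℕ) : Subgroup (GL (Fin 2) (ZInv p)) :=
  (CongruenceSubgroup.Gamma0 N).map (Matrix.SpecialLinearGroup.mapGL (ZInv p))

/-- `Γ₀(N)' = (p 0; 0 1)⁻¹ Γ₀(N) (p 0; 0 1)`, as a subgroup of `GL₂(ℤ[1/p])`. -/
def Gamma0' (p N : ℕ) : Subgroup (GL (Fin 2) (ZInv p)) :=
  (Gamma0 p N).map (MulAut.conj (diagP p)⁻¹).toMonoidHom

theorem diagP_coe (p : ℕ) :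
    (diagP p : Matrix (Fin 2) (Fin 2) (ZInv p)) = !![(p : ZInv p), 0; 0, 1] := rfl

theorem mapGL_coe (p : ℕ) (γ : SL(2, ℤ)) (i j : Fin 2) :
    (Matrix.SpecialLinearGroup.mapGL (ZInv p) γ : Matrix (Fin 2) (Fin 2) (ZInv p)) i j =
      ((γ i j : ℤ) : ZInv p) := by
  simp [Matrix.SpecialLinearGroup.mapGL_coe_matrix]

theorem Gamma0_mul_le (p M : ℕ) : Gamma0 p (M * p) ≤ Gamma0 p M := by
  refine Subgroup.map_mono fun γ hγ => ?_
  rw [CongruenceSubgroup.Gamma0_mem, ZMod.intCast_zmod_eq_zero_iff_dvd] at hγ ⊢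
  exact (Int.natCast_dvd_natCast.2 (dvd_mul_right M p)).trans hγ

theorem Gamma0_mul_le' (p M : ℕ) : Gamma0 p (M * p) ≤ Gamma0' p M := by
  rintro _ ⟨γ, hγ, rfl⟩
  have hγ' := hγ
  rw [SetLike.mem_coe, CongruenceSubgroup.Gamma0_mem, ZMod.intCast_zmod_eq_zero_iff_dvd] at hγ'
  obtain ⟨c, hc⟩ := hγ'
  push_cast at hc
  have hdet : γ 0 0 * γ 1 1 - γ 0 1 * γ 1 0 = 1 := by rw [← Matrix.det_fin_two]; exact γ.2
  obtain ⟨ε, h00, h01, h10, h11⟩ : ∃ ε : SL(2, ℤ),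
      ε 0 0 = γ 0 0 ∧ ε 0 1 = p * γ 0 1 ∧ ε 1 0 = M * c ∧ ε 1 1 = γ 1 1 :=
    ⟨⟨!![γ 0 0, p * γ 0 1; M * c, γ 1 1], by
      rw [Matrix.det_fin_two_of]; linear_combination hdet + γ 0 1 * hc⟩, rfl, rfl, rfl, rfl⟩
  refine ⟨Matrix.SpecialLinearGroup.mapGL (ZInv p) ε, ⟨ε, ?_, rfl⟩, ?_⟩
  · rw [SetLike.mem_coe, CongruenceSubgroup.Gamma0_mem, ZMod.intCast_zmod_eq_zero_iff_dvd, h10]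
    exact ⟨c, rfl⟩
  · change (diagP p)⁻¹ * _ * (diagP p)⁻¹⁻¹ = _
    rw [inv_inv, mul_assoc, inv_mul_eq_iff_eq_mul]
    refine Units.ext ?_
    rw [Units.val_mul, Units.val_mul, diagP_coe, Matrix.eta_fin_two (Units.val (_ : GL _ _)),
      Matrix.eta_fin_two (Units.val (Matrix.SpecialLinearGroup.mapGL (ZInv p) γ)),
      Matrix.mul_fin_two, Matrix.mul_fin_two]
    simp only [mapGL_coe, h00, h01, h10, h11, hc]
    push_cast
    congr 1
    simp [mul_comm, mul_left_comm]

end Groups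

section Cohomology

variable {F : Type u} [Field F] {G : Type} [Group G] {W : Type u} [AddCommGroup W] [Module F W]

/-- The restriction of a representation of `G` to a subgroup `Γ`. The subgroup is lifted to the
universe of `F`, as the cohomology of the library requires. -/
abbrev resRep (ρ : Representation F G W) (Γ : Subgroup G) : Rep.{u} F (ULift.{u} Γ) :=
  Rep.of (ρ.comp (Γ.subtype.comp MulEquiv.ulift.toMonoidHom))

/-- The inclusion of subgroups `Δ ≤ Γ`. -/
def inclusion {Δ Γ : Subgroup G} (h : Δ ≤ Γ) : ULift.{u} Δ →* ULift.{u} Γ :=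
  MulEquiv.ulift.symm.toMonoidHom.comp ((Subgroup.inclusion h).comp MulEquiv.ulift.toMonoidHom)

/-- The first group cohomology `H¹(Γ, W)`. -/
abbrev H1 (ρ : Representation F G W) (Γ : Subgroup G) : Type u :=
  groupCohomology.H1 (resRep ρ Γ)

/-- The restriction map `H¹(Γ, W) → H¹(Δ, W)` for subgroups `Δ ≤ Γ`. -/
def restriction (ρ : Representation F G W) {Δ Γ : Subgroup G} (h : Δ ≤ Γ) :
    H1 ρ Γ →ₗ[F] H1 ρ Δ :=
  (groupCohomology.map (A := resRep ρ Γ) (B := resRep ρ Δ) (inclusion h)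
    (Rep.ofHom ⟨LinearMap.id, fun _ => rfl⟩) 1).hom

end Cohomology

section Main

variable {F : Type u} [Field F]

/-- If `ℓ = char F` does not divide a multiple of `p`, then `p` is invertible in `F`. -/
theorem isUnit_of_not_dvd (ℓ : ℕ) [CharP F ℓ] {p M : ℕ} (h : ¬ ℓ ∣ 6 * p * M) :
    IsUnit (p : F) := by
  rw [isUnit_iff_ne_zero, Ne, CharP.cast_eq_zero_iff F ℓ]
  exact fun hp => h ((hp.mul_left 6).mul_right M)

/-- The ring homomorphism `ℤ[1/p] → F`, when `p` is invertible in `F`. -/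
def toF {p : ℕ} (hp : IsUnit (p : F)) : ZInv p →+* F :=
  IsLocalization.Away.lift (p : ℤ) (g := Int.castRingHom F) (by simpa using hp)

/-- `V_w(F)` as a representation of `GL₂(ℤ[1/p])`, when `p` is invertible in `F`. -/
def rep (w : ℕ) {p : ℕ} (hp : IsUnit (p : F)) :
    Representation F (GL (Fin 2) (ZInv p)) (V F w) :=
  (polyRep F w).comp (Matrix.GeneralLinearGroup.map (toF hp))

/-- The sum of the restriction maps
`H¹(Γ₀(M), V_w(F)) ⊕ H¹(Γ₀(M)', V_w(F)) → H¹(Γ₀(Mp), V_w(F))`. -/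
def alpha (w M : ℕ) {p : ℕ} (hp : IsUnit (p : F)) :
    H1 (rep w hp) (Gamma0 p M) × H1 (rep w hp) (Gamma0' p M) →ₗ[F]
      H1 (rep w hp) (Gamma0 p (M * p)) :=
  (restriction (rep w hp) (Gamma0_mul_le p M)).coprod
    (restriction (rep w hp) (Gamma0_mul_le' p M))

end Main

end IharaFull

end

/-! A kernel element of `alpha` is a pair of cocycles on `Γ₀(M)` and `Γ₀(M)'` whose sum is a
coboundary on `Γ₀(Mp)`. After a sign change and a coboundary correction the two agree on `Γ₀(Mp)`.
The subgroup of `SL₂(ℤ[1/p])` generated by the two groups is their amalgamated product over `Γ₀(Mp)`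
(`amalgamHom_Gamma0_injective`, by ping-pong on row vectors with `p`-adic norms). The pair therefore
glues to one cocycle `φ` on this subgroup (`exists_cocycle_extension`, `exists_eq_kernelClass`), and
the question becomes which `φ` are not coboundaries.

The extra elements with denominators force `φ` on `Γ₀(M)` to depend only on residues modulo `ℓ`
(`cocycle_congr`). First, `φ` vanishes at unipotents with parameter `ℓ` (`cocycle_char_eq_zero`) and
at diagonal elements `(p ^ n, p ^ (-n))` sufficiently close to `1` modulo powers of `ℓ`
(`cocycle_tor_eq_zero`). If the upper left entry of `γ` divides `p ^ (2n) - 1`, conjugation of `γ`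
by such a diagonal element amounts to multiplication by unipotents on both sides (`diag_mul_mk2`).
Dirichlet's theorem arranges this divisibility with quotient known modulo `ℓ`
(`exists_special_corner`). Comparing the resulting relations for congruent matrices bounds `φ` on
elements trivial modulo `ℓ`, and a conjugation then gives zero.

What remains is essentially a cocycle on `SL₂(𝔽_ℓ)`, controlled by the Sylow subgroup of upper
unipotents. The only invariant is the coefficient of `X ^ w` in `φ(1 1; 0 1)`: if it vanishes, `φ`
is a coboundary (`exists_eq_coboundary`, by averaging over the `ℓ² - 1` nonzero vectors).
Compatibility with the diagonal torus forces it to vanish unless `ℓ - 1` divides `w + 2`, that is,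
unless `ℓ = w + 3` (`topCoeff_eq_zero`). In that case `(E|γ - E) / Δ`, with `Δ` the Dickson
invariant and `E` a form equal to `1` at all nonzero vectors over `𝔽_ℓ`, is a cocycle with invariant
`2 ≠ 0` (`topCoeff_specialCocycle`), so the kernel is a line. -/

noncomputable section

namespace IharaFull

universe u

/-! ### Amalgamated products: an injectivity criterion and the gluing of cocycles. -/

section Amalgam

open Monoid

variable {G : Type*} [Group G] {C : Subgroup G} {K : Bool → Subgroup G} (hC : ∀ i, C ≤ K i)

/-- The homomorphism from the amalgamated product of two subgroups of `G` over a common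
subgroup to `G`. -/
def amalgamHom : PushoutI (fun i => Subgroup.inclusion (hC i)) →* G :=
  PushoutI.lift (fun i => (K i).subtype) C.subtype fun _ => rfl

theorem amalgamHom_of (i : Bool) (g : K i) : amalgamHom hC (PushoutI.of i g) = g :=
  PushoutI.lift_of (φ := fun i => Subgroup.inclusion (hC i)) (fun i => (K i).subtype) C.subtype
    (fun _ => rfl) g

theorem amalgamHom_base (g : C) : amalgamHom hC (PushoutI.base _ g) = g := by
  rw [← PushoutI.of_apply_eq_base _ true, amalgamHom_of]; rfl

/-- The potential `N` increases strictly along a nonempty reduced word. -/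
theorem lt_of_reduced_word {α : Type*} (r : α → G → α) (hr1 : ∀ v, r v 1 = v)
    (hrm : ∀ v g h, r v (g * h) = r (r v g) h) (S : Bool → Set α) (N : α → ℚ)
    (hK : ∀ i, ∀ g ∈ K i, g ∉ C → ∀ v ∈ S i, r v g ∈ S (!i) ∧ N v < N (r v g))
    (l : List (Σ i, K i)) (hchain : l.IsChain fun x y => x.1 ≠ y.1)
    (hl : ∀ x ∈ l, (x.2 : G) ∉ C) (x : Σ i, K i) (hx : x ∈ l.head?) (v : α) (hv : v ∈ S x.1) :
    N v < N (r v (l.map fun y => (y.2 : G)).prod) := by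
  induction l generalizing x v with
  | nil => simp at hx
  | cons y l ih =>
    obtain rfl : y = x := by simpa using hx
    obtain ⟨h1, h2⟩ := hK y.1 y.2 y.2.2 (hl y (by simp)) v hv
    rw [List.map_cons, List.prod_cons, hrm]
    cases l with
    | nil => simpa [hr1] using h2
    | cons z l =>
      rw [List.isChain_cons_cons] at hchain
      refine h2.trans (ih hchain.2 (fun x hx => hl x (by simp [hx])) z (by simp) _ ?_)
      have : z.1 = !y.1 := by
        have := hchain.1
        revert this
        cases z.1 <;> cases y.1 <;> simp
      rwa [this]

/-- Ping-pong: in normal form, an element of the kernel is a base element times a reduced word. If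
the word is nonempty it raises the potential of a suitable `v`, yet it equals the inverse of a base
element, which preserves the potential. -/
theorem amalgamHom_injective {α : Type*} (r : α → G → α) (hr1 : ∀ v, r v 1 = v)
    (hrm : ∀ v g h, r v (g * h) = r (r v g) h) (S : Bool → Set α) (N : α → ℚ)
    (hK : ∀ i, ∀ g ∈ K i, g ∉ C → ∀ v ∈ S i, r v g ∈ S (!i) ∧ N v < N (r v g))
    (hCN : ∀ g ∈ C, ∀ i, ∀ v ∈ S i, N (r v g) = N v) (hS : ∀ i, (S i).Nonempty) :
    Function.Injective (amalgamHom hC) := by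
  rw [injective_iff_map_eq_one]
  classical
  intro x hx
  obtain ⟨d⟩ := PushoutI.NormalWord.transversal_nonempty (fun i => Subgroup.inclusion (hC i))
    fun i => Subgroup.inclusion_injective (hC i)
  obtain ⟨n, rfl⟩ : ∃ n : PushoutI.NormalWord d, n.prod = x :=
    ⟨_, PushoutI.NormalWord.equiv.left_inv x⟩
  have hprod : amalgamHom hC n.prod = n.head * (n.toList.map fun y => (y.2 : G)).prod := by
    rw [PushoutI.NormalWord.prod, map_mul]
    refine congrArg₂ (· * ·) (amalgamHom_base hC n.head) ?_
    rw [CoprodI.Word.prod, map_list_prod, map_list_prod, List.map_map, List.map_map]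
    refine congrArg List.prod (List.map_congr_left fun y _ => ?_)
    rw [Function.comp_apply, Function.comp_apply, PushoutI.ofCoprodI_of, amalgamHom_of]
  -- The letters of a normal form lie in a transversal containing `1`, so a letter that lay in `C`
  -- would be `1` by uniqueness of the decomposition.
  have hred : ∀ y ∈ n.toList, (y.2 : G) ∉ C := by
    intro y hy hyC
    have h1 : y.2 ∈ d.set y.1 := n.normalized y.1 y.2 hy
    have h2 := (d.compl y.1).1
      (a₁ := (⟨y.2, ⟨y.2, hyC⟩, rfl⟩, ⟨1, d.one_mem y.1⟩)) (a₂ := (1, ⟨y.2, h1⟩)) (by simp)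
    have h3 := congrArg (fun z => (z.2 : K y.1)) h2
    exact n.ne_one y hy h3.symm
  have hempty : n.toList = [] := by
    by_contra hne
    obtain ⟨y, hy⟩ : ∃ y, y ∈ n.toList.head? := by
      cases h : n.toList with
      | nil => exact absurd h hne
      | cons y l => exact ⟨y, by simp⟩
    obtain ⟨v, hv⟩ := hS y.1
    have h1 := lt_of_reduced_word r hr1 hrm S N hK n.toList n.chain_ne hred y hy v hv
    rw [hprod] at hx
    rw [eq_inv_of_mul_eq_one_right hx, hCN _ (inv_mem n.head.2) _ _ hv] at h1
    exact lt_irrefl _ h1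
  rw [hprod, hempty] at hx
  have hhead : n.head = 1 := Subtype.ext (by simpa using hx)
  rw [PushoutI.NormalWord.prod, CoprodI.Word.prod, hempty, hhead]
  simp

/-- A map is a cocycle on the subgroup `Γ`. -/
def IsCocycleOn {W : Type*} [AddCommGroup W] {F : Type*} [CommRing F] [Module F W]
    (ρ : Representation F G W) (Γ : Subgroup G) (f : G → W) : Prop :=
  ∀ g ∈ Γ, ∀ h ∈ Γ, f (g * h) = f g + ρ g (f h)

/-- A cocycle is the same as an affine action `w ↦ f g + ρ g w`. The two affine actions agree on
`C`, so the universal property yields an action of the amalgamated product, and the glued cocycle is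
the orbit map of `0`. -/
theorem exists_cocycle_extension {W : Type*} [AddCommGroup W] {F : Type*} [CommRing F]
    [Module F W] (ρ : Representation F G W) (hinj : Function.Injective (amalgamHom hC))
    (f : Bool → G → W) (hf : ∀ i, IsCocycleOn ρ (K i) (f i))
    (hfC : ∀ i, ∀ g ∈ C, f i g = f true g) :
    ∃ φ : G → W, IsCocycleOn ρ (⨆ i, K i) φ ∧ ∀ i, ∀ g ∈ K i, φ g = f i g := by
  have hf1 : ∀ i, f i 1 = 0 := fun i => by
    simpa using hf i 1 (one_mem _) 1 (one_mem _)
  let aff : ∀ i, K i →* Function.End W := fun i =>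
    { toFun := fun g w => f i g + ρ g w
      map_one' := by funext w; simp [hf1]; rfl
      map_mul' := fun g h => by
        funext w
        change f i (g * h) + ρ (g * h) w = f i g + ρ g (f i h + ρ h w)
        rw [hf i g g.2 h h.2, map_mul, map_add, Module.End.mul_apply, add_assoc] }
  let Φ : PushoutI (fun i => Subgroup.inclusion (hC i)) →* Function.End W :=
    PushoutI.lift aff ((aff true).comp (Subgroup.inclusion (hC true))) fun i => by
      refine MonoidHom.ext fun g => funext fun w => ?_
      change f i g + ρ g w = f true g + ρ g w
      rw [hfC i g g.2]
  have hΦof : ∀ i (g : K i) w, Φ (PushoutI.of i g) w = f i g + ρ g w := fun i g w => by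
    have : Φ (PushoutI.of i g) = aff i g := PushoutI.lift_of _ _ _ _
    rw [this]; rfl
  have hιof := amalgamHom_of hC
  have hΦ : ∀ x w, Φ x w = Φ x 0 + ρ (amalgamHom hC x) w := by
    intro x
    induction x using PushoutI.induction_on with
    | of i g => intro w; rw [hΦof, hΦof, hιof]; simp
    | base h =>
      intro w
      rw [← PushoutI.of_apply_eq_base _ true, hΦof, hΦof, hιof]; simp
    | mul x y hx hy =>
      intro w
      rw [map_mul, map_mul, map_mul]
      change Φ x (Φ y w) = Φ x (Φ y 0) + _
      rw [hx, hy, hx (Φ y 0), map_add, Module.End.mul_apply, add_assoc]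
  classical
  -- Injectivity makes the chosen preimage irrelevant; the value `0` off the range never matters,
  -- since both subgroups lie in the range.
  let φ : G → W := fun g => if h : ∃ x, amalgamHom hC x = g then Φ h.choose 0 else 0
  have hφ : ∀ x, φ (amalgamHom hC x) = Φ x 0 := fun x => by
    have h : ∃ y, amalgamHom hC y = amalgamHom hC x := ⟨x, rfl⟩
    simp only [φ, dif_pos h, hinj h.choose_spec]
  have hK : ∀ i, K i ≤ (amalgamHom hC).range := fun i g hg =>
    ⟨PushoutI.of i ⟨g, hg⟩, hιof i _⟩
  refine ⟨φ, ?_, fun i g hg => ?_⟩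
  · intro g hg h hh
    obtain ⟨x, rfl⟩ := iSup_le hK hg
    obtain ⟨y, rfl⟩ := iSup_le hK hh
    rw [← map_mul, hφ, hφ, hφ, map_mul]
    exact hΦ x (Φ y 0)
  · have := hφ (PushoutI.of i ⟨g, hg⟩)
    rwa [hιof, hΦof, map_zero, add_zero] at this

end Amalgam

/-! ### Explicit matrices of determinant one over `ℤ[1/p]`. -/

section Matrices

/-- The matrix `(a b; c d)` of determinant one, as an element of `GL₂`. -/
def mk2 {R : Type*} [CommRing R] (a b c d : R) (h : a * d - b * c = 1) : GL (Fin 2) R :=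
  ⟨!![a, b; c, d], !![d, -b; -c, a],
    by
      rw [Matrix.mul_fin_two, Matrix.one_fin_two]
      congr! <;> first | ring1 | linear_combination h,
    by
      rw [Matrix.mul_fin_two, Matrix.one_fin_two]
      congr! <;> first | ring1 | linear_combination h⟩

variable {R : Type*} [CommRing R]

theorem mk2_mul {a b c d a' b' c' d' : R} (h : a * d - b * c = 1) (h' : a' * d' - b' * c' = 1) :
    mk2 a b c d h * mk2 a' b' c' d' h' = mk2 (a * a' + b * c') (a * b' + b * d')
      (c * a' + d * c') (c * b' + d * d') (by linear_combination (a' * d' - b' * c') * h + h') :=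
  Units.ext (Matrix.mul_fin_two ..)

theorem mk2_inv {a b c d : R} (h : a * d - b * c = 1) :
    (mk2 a b c d h)⁻¹ = mk2 d (-b) (-c) a (by linear_combination h) :=
  Units.ext rfl

theorem mk2_congr {a b c d a' b' c' d' : R} {h : a * d - b * c = 1} {h' : a' * d' - b' * c' = 1}
    (h1 : a = a') (h2 : b = b') (h3 : c = c') (h4 : d = d') :
    mk2 a b c d h = mk2 a' b' c' d' h' := by
  subst h1 h2 h3 h4; rfl

theorem mk2_one : mk2 1 0 0 1 (by simp) = (1 : GL (Fin 2) R) :=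
  Units.ext Matrix.one_fin_two.symm

theorem eq_mk2_iff {a b c d : R} (h : a * d - b * c = 1) (g : GL (Fin 2) R) :
    g = mk2 a b c d h ↔ (g : Matrix (Fin 2) (Fin 2) R) = !![a, b; c, d] :=
  Units.ext_iff

/-- The inverse of `p` in `ℤ[1/p]`. -/
def pInv (p : ℕ) : ZInv p := IsLocalization.Away.invSelf (S := ZInv p) (p : ℤ)

theorem mul_pInv (p : ℕ) : (p : ZInv p) * pInv p = 1 := by
  simpa [pInv] using IsLocalization.Away.mul_invSelf (S := ZInv p) (p : ℤ)

theorem intDet {p : ℕ} {a b c d : ℤ} (h : a * d - b * c = 1) :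
    (a : ZInv p) * d - b * c = 1 := by exact_mod_cast congrArg (Int.cast : ℤ → ZInv p) h

/-- An integral matrix of determinant one, as an element of `GL₂(ℤ[1/p])`. -/
def mkZ (p : ℕ) (a b c d : ℤ) (h : a * d - b * c = 1) : GL (Fin 2) (ZInv p) :=
  mk2 (a : ZInv p) b c d (intDet h)

theorem mkZ_congr {p : ℕ} {a b c d a' b' c' d' : ℤ} {h : a * d - b * c = 1}
    {h' : a' * d' - b' * c' = 1} (h1 : a = a') (h2 : b = b') (h3 : c = c') (h4 : d = d') :
    mkZ p a b c d h = mkZ p a' b' c' d' h' := by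
  subst h1 h2 h3 h4; rfl

theorem mkZ_mul {p : ℕ} {a b c d a' b' c' d' : ℤ} (h : a * d - b * c = 1)
    (h' : a' * d' - b' * c' = 1) :
    mkZ p a b c d h * mkZ p a' b' c' d' h' = mkZ p (a * a' + b * c') (a * b' + b * d')
      (c * a' + d * c') (c * b' + d * d') (by linear_combination (a' * d' - b' * c') * h + h') := by
  rw [mkZ, mkZ, mk2_mul]
  apply mk2_congr <;> push_cast <;> rfl

theorem mem_Gamma0_iff {p N : ℕ} {g : GL (Fin 2) (ZInv p)} :
    g ∈ Gamma0 p N ↔ ∃ (a b c d : ℤ) (h : a * d - b * (N * c) = 1),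
      g = mkZ p a b (N * c) d h := by
  constructor
  · rintro ⟨γ, hγ, rfl⟩
    rw [SetLike.mem_coe, CongruenceSubgroup.Gamma0_mem, ZMod.intCast_zmod_eq_zero_iff_dvd] at hγ
    obtain ⟨c, hc⟩ := hγ
    have hdet : γ 0 0 * γ 1 1 - γ 0 1 * γ 1 0 = 1 := by rw [← Matrix.det_fin_two]; exact γ.2
    refine ⟨γ 0 0, γ 0 1, c, γ 1 1, by rw [← hc, hdet], ?_⟩
    refine (eq_mk2_iff _ _).2 ?_
    rw [Matrix.eta_fin_two (Units.val (Matrix.SpecialLinearGroup.mapGL (ZInv p) γ))]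
    simp only [mapGL_coe, hc]
  · rintro ⟨a, b, c, d, h, rfl⟩
    obtain ⟨γ, h00, h01, h10, h11⟩ : ∃ γ : SL(2, ℤ),
        γ 0 0 = a ∧ γ 0 1 = b ∧ γ 1 0 = N * c ∧ γ 1 1 = d :=
      ⟨⟨!![a, b; N * c, d], by rw [Matrix.det_fin_two_of, h]⟩, rfl, rfl, rfl, rfl⟩
    refine ⟨γ, ?_, ?_⟩
    · rw [SetLike.mem_coe, CongruenceSubgroup.Gamma0_mem, ZMod.intCast_zmod_eq_zero_iff_dvd, h10]
      exact ⟨c, rfl⟩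
    · refine (eq_mk2_iff _ _).2 ?_
      rw [Matrix.eta_fin_two (Units.val (Matrix.SpecialLinearGroup.mapGL (ZInv p) γ))]
      simp only [mapGL_coe, h00, h01, h10, h11]

theorem mkZ_mem {p N : ℕ} {a b c d : ℤ} (h : a * d - b * c = 1) (hc : (N : ℤ) ∣ c) :
    mkZ p a b c d h ∈ Gamma0 p N := by
  obtain ⟨c, rfl⟩ := hc
  exact mem_Gamma0_iff.2 ⟨a, b, c, d, h, rfl⟩

theorem det_conj {p : ℕ} {a b c d : ℤ} (h : a * d - b * c = 1) :
    (a : ZInv p) * d - b * pInv p * (p * c) = 1 := by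
  linear_combination intDet (p := p) h - (b : ZInv p) * c * mul_pInv p

theorem diagP_conj {p : ℕ} {a b c d : ℤ} (h : a * d - b * c = 1) :
    (diagP p)⁻¹ * mkZ p a b c d h * diagP p =
      mk2 (a : ZInv p) (b * pInv p) (p * c) d (det_conj h) := by
  rw [mul_assoc, inv_mul_eq_iff_eq_mul]
  refine Units.ext ?_
  rw [Units.val_mul, Units.val_mul, diagP_coe]
  change !![(a : ZInv p), b; c, d] * _ = _ * !![(a : ZInv p), b * pInv p; p * c, d]
  rw [Matrix.mul_fin_two, Matrix.mul_fin_two]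
  congr! 1
  simp only [mul_zero, zero_mul, add_zero, zero_add, mul_one, one_mul]
  congr! 2
  · ring
  · congr! 1
    linear_combination -(b : ZInv p) * mul_pInv p
  · congr! 1
    ring

theorem mem_Gamma0'_iff {p N : ℕ} {g : GL (Fin 2) (ZInv p)} :
    g ∈ Gamma0' p N ↔ ∃ (a b c d : ℤ) (h : a * d - b * (N * c) = 1),
      g = mk2 (a : ZInv p) (b * pInv p) (p * (N * c : ℤ)) d (det_conj h) := by
  constructor
  · rintro ⟨_, hγ, rfl⟩
    obtain ⟨a, b, c, d, h, rfl⟩ := mem_Gamma0_iff.1 hγ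
    refine ⟨a, b, c, d, h, ?_⟩
    rw [← diagP_conj]
    change (diagP p)⁻¹ * _ * (diagP p)⁻¹⁻¹ = _
    rw [inv_inv]
  · rintro ⟨a, b, c, d, h, rfl⟩
    refine ⟨_, mem_Gamma0_iff.2 ⟨a, b, c, d, h, rfl⟩, ?_⟩
    rw [← diagP_conj]
    change (diagP p)⁻¹ * _ * (diagP p)⁻¹⁻¹ = _
    rw [inv_inv]

end Matrices

/-! ### Ping-pong with `p`-adic norms. -/

section PingPong

variable {p : ℕ} (hp : p.Prime)

/-- The embedding of `ℤ[1/p]` in the rational numbers. -/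
def toQ : ZInv p →+* ℚ :=
  IsLocalization.Away.lift (p : ℤ) (g := Int.castRingHom ℚ)
    (by simpa using hp.ne_zero)

theorem toQ_pInv : toQ hp (pInv p) = (p : ℚ)⁻¹ := by
  have := congrArg (toQ hp) (mul_pInv p)
  rw [map_mul, map_natCast, map_one] at this
  exact (inv_eq_of_mul_eq_one_right this).symm

/-- The right action of matrices on rational row vectors. -/
def rowAct (v : ℚ × ℚ) (g : GL (Fin 2) (ZInv p)) : ℚ × ℚ :=
  (v.1 * toQ hp (g.1 0 0) + v.2 * toQ hp (g.1 1 0), v.1 * toQ hp (g.1 0 1) + v.2 * toQ hp (g.1 1 1))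

theorem rowAct_one (v : ℚ × ℚ) : rowAct hp v 1 = v := by
  simp [rowAct]

theorem rowAct_mul (v : ℚ × ℚ) (g h : GL (Fin 2) (ZInv p)) :
    rowAct hp v (g * h) = rowAct hp (rowAct hp v g) h := by
  simp only [rowAct, Units.val_mul, Matrix.mul_apply, Fin.sum_univ_two, map_add, map_mul]
  ext <;> ring

theorem rowAct_mk2 (x y : ℚ) {a b c d : ZInv p} (h : a * d - b * c = 1) :
    rowAct hp (x, y) (mk2 a b c d h) = (x * toQ hp a + y * toQ hp c, x * toQ hp b + y * toQ hp d) :=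
  rfl

/-- The two sets of row vectors exchanged by the two factors of the amalgam. -/
def pingSet (p : ℕ) : Bool → Set (ℚ × ℚ)
  | true => {v | padicNorm p v.1 < padicNorm p v.2}
  | false => {v | padicNorm p v.2 ≤ padicNorm p v.1 ∧ 0 < padicNorm p v.1}

/-- The potential that increases along reduced words. -/
def pingPotential (p : ℕ) (v : ℚ × ℚ) : ℚ :=
  -- Passing from the first set to the second keeps the larger norm, and passing back multiplies it
  -- by `p`. The weight `3 / 2` lies strictly between `1` and `2 ≤ p`, so both moves raise the
  -- potential.
  if padicNorm p v.1 < padicNorm p v.2 then padicNorm p v.2 else 3 / 2 * padicNorm p v.1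

theorem pingPotential_true {v : ℚ × ℚ} (hv : v ∈ pingSet p true) :
    pingPotential p v = padicNorm p v.2 := if_pos hv

theorem pingPotential_false {v : ℚ × ℚ} (hv : v ∈ pingSet p false) :
    pingPotential p v = 3 / 2 * padicNorm p v.1 := if_neg (not_lt.2 hv.1)

variable [Fact p.Prime]

theorem padicNorm_add_of_lt {x y : ℚ} (h : padicNorm p x < padicNorm p y) :
    padicNorm p (x + y) = padicNorm p y := by
  rw [padicNorm.add_eq_max_of_ne h.ne, max_eq_right h.le]

theorem padicNorm_add_le {x y z : ℚ} (hx : padicNorm p x ≤ z) (hy : padicNorm p y ≤ z) :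
    padicNorm p (x + y) ≤ z :=
  padicNorm.nonarchimedean.trans (max_le hx hy)

theorem padicNorm_mul_int_le (x : ℚ) (a : ℤ) : padicNorm p (x * a) ≤ padicNorm p x := by
  rw [padicNorm.mul]
  exact mul_le_of_le_one_right (padicNorm.nonneg _) (padicNorm.of_int a)

theorem padicNorm_mul_int_eq (x : ℚ) {a : ℤ} (ha : ¬ (p : ℤ) ∣ a) :
    padicNorm p (x * a) = padicNorm p x := by
  rw [padicNorm.mul, (padicNorm.int_eq_one_iff a).2 ha, mul_one]

theorem padicNorm_mul_int_lt {x : ℚ} (hx : 0 < padicNorm p x) {a : ℤ} (ha : (p : ℤ) ∣ a) :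
    padicNorm p (x * a) < padicNorm p x := by
  rw [padicNorm.mul]
  exact mul_lt_of_lt_one_right hx ((padicNorm.int_lt_one_iff a).2 ha)

variable {M : ℕ} (hpM : ¬ p ∣ M)

/-- The two factors of the amalgam. -/
def factor (p M : ℕ) : Bool → Subgroup (GL (Fin 2) (ZInv p))
  | true => Gamma0 p M
  | false => Gamma0' p M

theorem Gamma0_mul_le_factor (p M : ℕ) : ∀ i, Gamma0 p (M * p) ≤ factor p M i
  | true => Gamma0_mul_le p M
  | false => Gamma0_mul_le' p M

-- Outside `Γ₀(Mp)` the lower left entry is a `p`-adic unit, since `p ∤ M`; hence the new first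
-- coordinate has the norm of the old second one.
include hpM in
theorem ping_true {g : GL (Fin 2) (ZInv p)} (hg : g ∈ Gamma0 p M) (hgC : g ∉ Gamma0 p (M * p))
    {v : ℚ × ℚ} (hv : v ∈ pingSet p true) :
    rowAct hp v g ∈ pingSet p false ∧ pingPotential p v < pingPotential p (rowAct hp v g) := by
  obtain ⟨a, b, c, d, h, rfl⟩ := mem_Gamma0_iff.1 hg
  have hpc : ¬ (p : ℤ) ∣ M * c := by
    intro hdvd
    have hpM' : ¬ (p : ℤ) ∣ M := by rwa [Int.natCast_dvd_natCast]
    obtain ⟨c, rfl⟩ := ((Nat.prime_iff_prime_int.1 hp).dvd_mul.1 hdvd).resolve_left hpM'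
    exact hgC (mkZ_mem _ ⟨c, by push_cast; ring⟩)
  obtain ⟨x, y⟩ := v
  have hv' : padicNorm p x < padicNorm p y := hv
  have hy : 0 < padicNorm p y := (padicNorm.nonneg x).trans_lt hv'
  have hx1 : padicNorm p (x * a + y * (M * c : ℤ)) = padicNorm p y := by
    rw [padicNorm_add_of_lt, padicNorm_mul_int_eq y hpc]
    rw [padicNorm_mul_int_eq y hpc]
    exact (padicNorm_mul_int_le _ _).trans_lt hv'
  have hy1 : padicNorm p (x * b + y * d) ≤ padicNorm p y :=
    padicNorm_add_le ((padicNorm_mul_int_le _ _).trans hv'.le) (padicNorm_mul_int_le _ _)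
  have hmem : rowAct hp (x, y) (mkZ p a b (M * c) d h) ∈ pingSet p false := by
    rw [mkZ, rowAct_mk2]
    simp only [map_intCast]
    exact ⟨by rwa [hx1], by rwa [hx1]⟩
  refine ⟨hmem, ?_⟩
  rw [pingPotential_true hv, pingPotential_false hmem, mkZ, rowAct_mk2]
  simp only [map_intCast]
  rw [hx1]
  linarith

/-- Outside `Γ₀(Mp)` the upper right entry has a genuine denominator `p`, so it multiplies the norm
by `p` and the new second coordinate dominates. -/
theorem ping_false {g : GL (Fin 2) (ZInv p)} (hg : g ∈ Gamma0' p M) (hgC : g ∉ Gamma0 p (M * p))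
    {v : ℚ × ℚ} (hv : v ∈ pingSet p false) :
    rowAct hp v g ∈ pingSet p true ∧ pingPotential p v < pingPotential p (rowAct hp v g) := by
  obtain ⟨a, b, c, d, h, rfl⟩ := mem_Gamma0'_iff.1 hg
  have hpb : ¬ (p : ℤ) ∣ b := by
    rintro ⟨b, rfl⟩
    refine hgC (mem_Gamma0_iff.2 ⟨a, b, c, d, ?_, ?_⟩)
    · push_cast; linear_combination h
    · refine mk2_congr rfl ?_ ?_ rfl
      · push_cast; linear_combination (b : ZInv p) * mul_pInv p
      · push_cast; ring
  obtain ⟨x, y⟩ := v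
  have hv' : padicNorm p y ≤ padicNorm p x ∧ 0 < padicNorm p x := hv
  have hp2 : (2 : ℚ) ≤ p := by exact_mod_cast hp.two_le
  have hxb : padicNorm p (x * (b * (p : ℚ)⁻¹)) = p * padicNorm p x := by
    rw [← mul_assoc, padicNorm.mul, padicNorm_mul_int_eq _ hpb, ← one_div, padicNorm.div,
      padicNorm.padicNorm_p_of_prime, padicNorm.one, one_div, inv_inv, mul_comm]
  have hlt : padicNorm p x < p * padicNorm p x := by nlinarith [hv'.2]
  have hx1 : padicNorm p (x * a + y * (p * (M * c : ℤ))) ≤ padicNorm p x := by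
    refine padicNorm_add_le (padicNorm_mul_int_le _ _) ?_
    have := padicNorm_mul_int_le (p := p) y (p * (M * c))
    push_cast at this ⊢
    exact this.trans hv'.1
  have hy1 : padicNorm p (x * (b * (p : ℚ)⁻¹) + y * d) = p * padicNorm p x := by
    rw [add_comm, padicNorm_add_of_lt, hxb]
    rw [hxb]
    exact ((padicNorm_mul_int_le _ _).trans hv'.1).trans_lt hlt
  have hrow : rowAct hp (x, y) (mk2 (a : ZInv p) (b * pInv p) (p * (M * c : ℤ)) d (det_conj h)) =
      (x * a + y * (p * (M * c : ℤ)), x * (b * (p : ℚ)⁻¹) + y * d) := by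
    rw [rowAct_mk2]
    simp only [map_intCast, map_mul, map_natCast, toQ_pInv]
  have hmem : rowAct hp (x, y) (mk2 (a : ZInv p) (b * pInv p) (p * (M * c : ℤ)) d (det_conj h)) ∈
      pingSet p true := by
    rw [hrow]
    exact hx1.trans_lt (by rwa [hy1])
  refine ⟨hmem, ?_⟩
  rw [pingPotential_false hv, pingPotential_true hmem, hrow]
  simp only
  rw [hy1]
  nlinarith [hv'.2]

theorem pingPotential_base {g : GL (Fin 2) (ZInv p)} (hgC : g ∈ Gamma0 p (M * p))
    (i : Bool) {v : ℚ × ℚ} (hv : v ∈ pingSet p i) :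
    pingPotential p (rowAct hp v g) = pingPotential p v := by
  obtain ⟨a, b, c, d, h, rfl⟩ := mem_Gamma0_iff.1 hgC
  have hpc : (p : ℤ) ∣ (M * p : ℕ) * c := ⟨M * c, by push_cast; ring⟩
  have hpad : ¬ (p : ℤ) ∣ a * d := fun hd =>
    (Nat.prime_iff_prime_int.1 hp).not_dvd_one (h ▸ hd.sub (hpc.mul_left b))
  have hpa : ¬ (p : ℤ) ∣ a := fun ha => hpad (ha.mul_right d)
  have hpd : ¬ (p : ℤ) ∣ d := fun hd => hpad (hd.mul_left a)
  obtain ⟨x, y⟩ := v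
  have hrow : rowAct hp (x, y) (mkZ p a b ((M * p : ℕ) * c) d h) =
      (x * a + y * ((M * p : ℕ) * c : ℤ), x * b + y * d) := by
    rw [mkZ, rowAct_mk2]
    simp only [map_intCast]
  cases i with
  | true =>
    have hv' : padicNorm p x < padicNorm p y := hv
    have hy : 0 < padicNorm p y := (padicNorm.nonneg x).trans_lt hv'
    have hy1 : padicNorm p (x * b + y * d) = padicNorm p y := by
      rw [padicNorm_add_of_lt, padicNorm_mul_int_eq _ hpd]
      rw [padicNorm_mul_int_eq _ hpd]
      exact (padicNorm_mul_int_le _ _).trans_lt hv'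
    have hx1 : padicNorm p (x * a + y * ((M * p : ℕ) * c : ℤ)) < padicNorm p y :=
      padicNorm.nonarchimedean.trans_lt
        (max_lt ((padicNorm_mul_int_le _ _).trans_lt hv') (padicNorm_mul_int_lt hy hpc))
    rw [pingPotential_true hv, hrow, pingPotential_true]
    · exact hy1
    · change padicNorm p _ < padicNorm p _
      rwa [hy1]
  | false =>
    have hv' : padicNorm p y ≤ padicNorm p x ∧ 0 < padicNorm p x := hv
    have hy1 : padicNorm p (x * b + y * d) ≤ padicNorm p x :=
      padicNorm_add_le (padicNorm_mul_int_le _ _) ((padicNorm_mul_int_le _ _).trans hv'.1)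
    have hyc : padicNorm p (y * ((M * p : ℕ) * c : ℤ)) < padicNorm p x := by
      rcases (padicNorm.nonneg (p := p) y).eq_or_lt with h0 | h0
      · rw [padicNorm.mul, ← h0, zero_mul]; exact hv'.2
      · exact (padicNorm_mul_int_lt h0 hpc).trans_le hv'.1
    have hx1 : padicNorm p (x * a + y * ((M * p : ℕ) * c : ℤ)) = padicNorm p x := by
      rw [add_comm, padicNorm_add_of_lt, padicNorm_mul_int_eq _ hpa]
      rwa [padicNorm_mul_int_eq _ hpa]
    rw [pingPotential_false hv, hrow, pingPotential_false]
    · rw [hx1]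
    · exact ⟨by rwa [hx1], by rw [hx1]; exact hv'.2⟩

include hp hpM in
theorem amalgamHom_Gamma0_injective :
    Function.Injective (amalgamHom (Gamma0_mul_le_factor p M)) := by
  refine amalgamHom_injective _ (rowAct hp) (rowAct_one hp) (rowAct_mul hp) (pingSet p)
    (pingPotential p) ?_ (fun g hg i v hv => pingPotential_base hp hg i hv) ?_
  · rintro (_ | _) g hg hgC v hv
    · exact ping_false hp hg hgC hv
    · exact ping_true hp hpM hg hgC hv
  · rintro (_ | _)
    · exact ⟨(1, 0), by simp [pingSet]⟩
    · exact ⟨(0, 1), by simp [pingSet]⟩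

end PingPong

/-! ### Elementary operations on cocycles. -/

section Cocycles

variable {G : Type*} [Group G] {W : Type*} [AddCommGroup W] {F : Type*} [CommRing F] [Module F W]
  {ρ : Representation F G W} {Γ : Subgroup G} {φ : G → W}

theorem IsCocycleOn.mono (hφ : IsCocycleOn ρ Γ φ) {Δ : Subgroup G} (h : Δ ≤ Γ) :
    IsCocycleOn ρ Δ φ := fun g hg k hk => hφ g (h hg) k (h hk)

theorem IsCocycleOn.map_one (hφ : IsCocycleOn ρ Γ φ) : φ 1 = 0 := by
  simpa using hφ 1 (one_mem _) 1 (one_mem _)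

theorem IsCocycleOn.sub_coboundary (hφ : IsCocycleOn ρ Γ φ) (v : W) :
    IsCocycleOn ρ Γ fun g => φ g - (ρ g v - v) := fun g hg h hh => by
  beta_reduce
  rw [hφ g hg h hh, map_mul, Module.End.mul_apply, map_sub, map_sub]
  abel

end Cocycles

/-! ### Unipotent matrices acting on polynomials: fixed vectors and norms. -/

section Slash

variable {F : Type u} [Field F] {w : ℕ}

theorem slash_const (γ : Matrix (Fin 2) (Fin 2) F) (c : F) :
    slash w γ (C c) = C c * (C (γ 1 0) * X + C (γ 1 1)) ^ w := by
  rw [slash_apply, Finset.sum_eq_single 0]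
  · simp
  · intro i _ hi
    simp [coeff_C, hi]
  · simp

theorem slash_monomial (γ : Matrix (Fin 2) (Fin 2) F) (c : F) :
    slash w γ (C c * X ^ w) = C c * (C (γ 0 0) * X + C (γ 0 1)) ^ w := by
  rw [slash_apply, Finset.sum_eq_single w]
  · simp
  · intro i _ hi
    simp [coeff_X_pow, hi]
  · simp

theorem slash_upper {P : F[X]} (hP : P ∈ V F w) (s : F) :
    slash w !![1, s; 0, 1] P = P.comp (X + C s) := by
  rw [slash_apply, comp, eval₂_eq_sum_range' _ (Nat.lt_succ_of_le (mem_V_iff.1 hP))]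
  simp

theorem coeff_linear_pow (a b : F) : ((C a * X + C b) ^ w).coeff w = a ^ w := by
  have h := coeff_pow_of_natDegree_le (natDegree_linear_le a b) (m := w)
  rw [mul_one] at h
  rw [h, coeff_add, coeff_C_mul, coeff_X_one, coeff_C_of_ne_zero one_ne_zero, add_zero, mul_one]

theorem coeff_slash_of_lower_left_eq_zero (a b d : F) (P : F[X]) :
    (slash w !![a, b; 0, d] P).coeff w = a ^ w * P.coeff w := by
  rw [slash_apply, finsetSum_coeff, Finset.sum_eq_single w]
  · change (C (P.coeff w) * ((C a * X + C b) ^ w * _ ^ (w - w))).coeff w = _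
    rw [Nat.sub_self, pow_zero, mul_one, coeff_C_mul, coeff_linear_pow, mul_comm]
  · intro i hi hne
    have hi' : i < w := lt_of_le_of_ne (Nat.lt_succ_iff.1 (Finset.mem_range.1 hi)) hne
    refine coeff_eq_zero_of_natDegree_lt (lt_of_le_of_lt ?_ hi')
    refine (natDegree_C_mul_le _ _).trans ?_
    have h1 := natDegree_pow_le_of_le i (natDegree_linear_le a b)
    have h2 : ((C (0 : F) * X + C d) ^ (w - i)).natDegree = 0 := by
      rw [C_0, zero_mul, zero_add, ← C_pow, natDegree_C]
    refine natDegree_mul_le.trans ?_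
    simp only [Matrix.of_apply, Matrix.cons_val', Matrix.cons_val_zero, Matrix.cons_val_fin_one,
      Matrix.cons_val_one] at *
    omega
  · simp

theorem slash_swap_swap {P : F[X]} (hP : P ∈ V F w) :
    slash w !![0, 1; 1, 0] (slash w !![0, 1; 1, 0] P) = P := by
  rw [← slash_mul]
  convert slash_one hP
  rw [Matrix.mul_fin_two, Matrix.one_fin_two]
  simp

/-- Conjugation by the swap of coordinates reduces lower unipotents to upper ones. -/
theorem slash_lower (s : F) (P : F[X]) :
    slash w !![1, 0; s, 1] P =
      slash w !![0, 1; 1, 0] (slash w !![1, s; 0, 1] (slash w !![0, 1; 1, 0] P)) := by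
  rw [← slash_mul, ← slash_mul, Matrix.mul_fin_two, Matrix.mul_fin_two]
  simp

variable {ℓ : ℕ} [CharP F ℓ]

/-- Invariance under translation by `s` gives the same value at the `ℓ` distinct points `0, s, …, (ℓ
- 1) s`, more than the degree allows for a nonconstant polynomial. -/
theorem eq_C_of_slash_upper_eq (hw : w < ℓ) {P : F[X]} (hP : P ∈ V F w) {s : F} (hs : s ≠ 0)
    (h : slash w !![1, s; 0, 1] P = P) : P = C (P.coeff 0) := by
  rw [slash_upper hP] at h
  have heval : ∀ n : ℕ, P.eval (n * s) = P.eval 0 := by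
    intro n
    induction n with
    | zero => simp
    | succ n ih =>
      rw [← ih]
      conv_rhs => rw [← h]
      simp [add_mul]
  refine eq_of_natDegree_lt_card_of_eval_eq P (C (P.coeff 0)) (f := fun i : Fin ℓ => (i : F) * s)
    ?_ ?_ ?_
  · intro i j hij
    have h2 : ((i : ℕ) : F) = (j : ℕ) := mul_right_cancel₀ hs hij
    rw [CharP.natCast_eq_natCast F ℓ] at h2
    exact Fin.ext (Nat.ModEq.eq_of_lt_of_lt h2 i.2 j.2)
  · intro i
    rw [heval, eval_C, coeff_zero_eq_eval_zero]
  · rw [Fintype.card_fin, natDegree_C]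
    exact max_lt ((mem_V_iff.1 hP).trans_lt hw) ((Nat.zero_le _).trans_lt hw)

theorem exists_eq_of_slash_lower_eq (hw : w < ℓ) {P : F[X]} (hP : P ∈ V F w) {s : F} (hs : s ≠ 0)
    (h : slash w !![1, 0; s, 1] P = P) : ∃ c, P = C c * X ^ w := by
  have hQ := slash_mem w !![0, 1; 1, 0] P
  rw [slash_lower] at h
  have h2 := congrArg (slash w !![0, 1; 1, 0]) h
  rw [slash_swap_swap (slash_mem _ _ _)] at h2
  have h3 := eq_C_of_slash_upper_eq hw hQ hs h2
  refine ⟨(slash w !![0, 1; 1, 0] P).coeff 0, ?_⟩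
  conv_lhs => rw [← slash_swap_swap hP, h3, slash_const]
  simp

variable [Fact ℓ.Prime]

theorem sum_pow_eq_zero {j : ℕ} (hj : j + 1 < ℓ) : ∑ i ∈ Finset.range ℓ, (i : F) ^ j = 0 := by
  have h := FiniteField.sum_pow_lt_card_sub_one (ZMod ℓ) j (by rw [ZMod.card]; omega)
  have h2 := congrArg (ZMod.castHom (dvd_refl ℓ) F) h
  rw [map_sum, map_zero] at h2
  rw [← h2, ← Fin.sum_univ_eq_sum_range fun i => (i : F) ^ j]
  refine Fintype.sum_equiv (ZMod.finEquiv ℓ).toEquiv _ _ fun i => ?_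
  rw [map_pow]
  congr 1
  have : NeZero ℓ := ⟨(Fact.out : ℓ.Prime).ne_zero⟩
  have h3 : (ZMod.finEquiv ℓ).toEquiv i = ((i : ℕ) : ZMod ℓ) := by
    obtain ⟨n, rfl⟩ := Nat.exists_eq_succ_of_ne_zero this.out
    exact (Fin.cast_val_eq_self i).symm
  rw [h3, map_natCast]

/-- The Taylor coefficients of the sum are combinations of the power sums of exponent at most `w < ℓ
- 1` over `𝔽_ℓ`, which vanish. For `w = ℓ - 1` this breaks down, and `cocycle_char_relation` takes
its place. -/
theorem sum_slash_upper_eq_zero (hw : w + 1 < ℓ) {P : F[X]} (hP : P ∈ V F w) (s : F) :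
    ∑ i ∈ Finset.range ℓ, slash w !![1, i * s; 0, 1] P = 0 := by
  have hpow : ∀ i : ℕ, slash w !![1, i * s; 0, 1] P = taylor (i * s) P := fun i => by
    rw [slash_upper hP, taylor_apply]
  simp only [hpow]
  ext j
  simp only [finsetSum_coeff, taylor_coeff, coeff_zero]
  set Q := hasseDeriv j P
  have hQ : Q.natDegree < w + 1 :=
    Nat.lt_succ_of_le ((natDegree_hasseDeriv_le P j).trans ((Nat.sub_le _ _).trans (mem_V_iff.1 hP)))
  simp only [eval_eq_sum_range' hQ]
  rw [Finset.sum_comm]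
  refine Finset.sum_eq_zero fun k hk => ?_
  simp only [mul_pow]
  rw [← Finset.mul_sum, ← Finset.sum_mul, sum_pow_eq_zero (by have := Finset.mem_range.1 hk; omega)]
  simp

theorem sum_slash_lower_eq_zero (hw : w + 1 < ℓ) (s : F) (P : F[X]) :
    ∑ i ∈ Finset.range ℓ, slash w !![1, 0; i * s, 1] P = 0 := by
  simp only [slash_lower]
  rw [← map_sum, sum_slash_upper_eq_zero hw (slash_mem _ _ _), map_zero]

end Slash

/-! ### Powers of `p` near `1` modulo powers of `ℓ`, and primes in progressions. -/

section Arithmetic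

variable {p ℓ : ℕ}

theorem dvd_pow_sub_one {q : ℕ} (hq : q.Prime) (hp : p.Prime) (hne : q ≠ p) {n : ℕ}
    (hn : (q - 1) ∣ n) : (q : ℤ) ∣ (p : ℤ) ^ n - 1 := by
  obtain ⟨k, rfl⟩ := hn
  have hcop : IsCoprime (p : ℤ) q :=
    Nat.isCoprime_iff_coprime.2 ((Nat.coprime_primes hp hq).2 hne.symm)
  have h := (Int.ModEq.pow_card_sub_one_eq_one hq hcop).symm.dvd
  rw [pow_mul]
  exact h.trans (by simpa using sub_dvd_pow_sub_pow ((p : ℤ) ^ (q - 1)) 1 k)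

/-- A power of `p` with exponent divisible by `ℓ - 1`, close to `1` in the `ℓ`-adic sense. -/
theorem exists_pow_eq_one_add (hp : p.Prime) (hl : ℓ.Prime) (hne : ℓ ≠ p) :
    ∃ (N E : ℕ) (q : ℤ), 2 ≤ E ∧ (ℓ - 1) ∣ N ∧ (p : ℤ) ^ (2 * N) = 1 + ℓ ^ E * q ∧
      ¬ (ℓ : ℤ) ∣ q := by
  have hl1 : 0 < ℓ - 1 := Nat.sub_pos_of_lt hl.one_lt
  set N := (ℓ - 1) * ℓ with hN
  -- The `ℓ`-th power of a number congruent to `1` modulo `ℓ` is congruent to `1` modulo `ℓ ^ 2`;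
  -- hence the factor `ℓ` in `N`.
  have hsq : (ℓ : ℤ) ^ 2 ∣ (p : ℤ) ^ (2 * N) - 1 := by
    have h := dvd_sub_pow_of_dvd_sub (R := ℤ)
      (dvd_pow_sub_one hl hp hne (n := 2 * (ℓ - 1)) (dvd_mul_left _ _)) 1
    rwa [pow_one, one_pow, ← pow_mul, mul_assoc] at h
  have hpos : (p : ℤ) ^ (2 * N) - 1 ≠ 0 := by
    have h1 : 1 < p ^ (2 * N) := Nat.one_lt_pow (by have := hl.pos; positivity) hp.one_lt
    have h2 : (1 : ℤ) < (p : ℤ) ^ (2 * N) := by exact_mod_cast h1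
    omega
  have hfin : FiniteMultiplicity (ℓ : ℤ) ((p : ℤ) ^ (2 * N) - 1) :=
    Int.finiteMultiplicity_iff.2 ⟨by simpa using hl.ne_one, hpos⟩
  obtain ⟨q, hq, hq'⟩ := hfin.exists_eq_pow_mul_and_not_dvd
  exact ⟨N, _, q, hfin.le_multiplicity_of_pow_dvd hsq, dvd_mul_right _ _,
    by linear_combination hq, hq'⟩

theorem exists_one_add_pow_eq (x : ℤ) (k : ℕ) : ∃ y, (1 + x) ^ k = 1 + k * x + x ^ 2 * y := by
  induction k with
  | zero => exact ⟨0, by simp⟩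
  | succ k ih =>
    obtain ⟨y, hy⟩ := ih
    refine ⟨k + y + x * y, ?_⟩
    rw [pow_succ, hy]
    push_cast
    ring

/-- With `n = N (r - 1)`, Fermat makes `p ^ (2n) - 1` divisible by `r`, and the binomial expansion
gives `r m ≡ (r - 1) q` modulo `ℓ`. As `r ≡ 2`, the residue of `m` is `q / 2` whatever `r` is, so
relations obtained from different primes can be compared. -/
theorem exists_pow_sub_one_eq (hp : p.Prime) (hl : ℓ.Prime) (hl2 : 2 < ℓ) {N E : ℕ} {q : ℤ}
    (hE : 2 ≤ E) (hN : (ℓ - 1) ∣ N) (hq : (p : ℤ) ^ (2 * N) = 1 + ℓ ^ E * q)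
    {r : ℕ} (hr : r.Prime) (hrp : r ≠ p) (hrl : (ℓ : ℤ) ∣ r - 2) :
    ∃ (n : ℕ) (m : ℤ), (ℓ - 1) ∣ n ∧ (p : ℤ) ^ (2 * n) - 1 = ℓ ^ E * (r * m) ∧
      (ℓ : ℤ) ∣ 2 * m - q := by
  obtain ⟨y, hy⟩ := exists_one_add_pow_eq (ℓ ^ E * q) (r - 1)
  have hcast : ((r - 1 : ℕ) : ℤ) = r - 1 := by push_cast [hr.one_le]; rfl
  have hkey : (p : ℤ) ^ (2 * (N * (r - 1))) - 1 =
      ℓ ^ E * ((r - 1) * q + ℓ ^ E * q ^ 2 * y) := by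
    rw [← mul_assoc, pow_mul, hq, hy, hcast]
    ring
  have hrdvd : (r : ℤ) ∣ ℓ ^ E * ((r - 1) * q + ℓ ^ E * q ^ 2 * y) :=
    hkey ▸ dvd_pow_sub_one hr hp hrp ((dvd_mul_left (r - 1) N).mul_left 2)
  have hne : r ≠ ℓ := by
    rintro rfl
    have h2 : (r : ℤ) ∣ 2 := (dvd_sub_right (dvd_refl (r : ℤ))).1 hrl
    have := Int.le_of_dvd two_pos h2
    omega
  have hcop : IsCoprime (r : ℤ) (ℓ ^ E) :=
    (Nat.isCoprime_iff_coprime.2 ((Nat.coprime_primes hr hl).2 hne)).pow_right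
  obtain ⟨m, hm⟩ := hcop.dvd_of_dvd_mul_left hrdvd
  refine ⟨N * (r - 1), m, hN.mul_right _, by rw [hkey, hm], ?_⟩
  obtain ⟨k, hk⟩ := hrl
  obtain ⟨E, rfl⟩ : ∃ E', E = E' + 1 := ⟨E - 1, by omega⟩
  exact ⟨k * q - k * m + ℓ ^ E * q ^ 2 * y, by rw [pow_succ] at hm; linear_combination (q - m) * hk - hm⟩

/-- Dirichlet's theorem, in the form used to prescribe a corner of a matrix up to elementary
operations. -/
theorem exists_prime_corner (hl : ℓ.Prime) (hl2 : 2 < ℓ) {j : ℕ} (hj : j ≠ 0) {a b M : ℤ}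
    (hla : (ℓ : ℤ) ∣ a) (hab : IsCoprime a b) (haM : IsCoprime a M) (hM : M ≠ 0) (hb : b ≠ 0) :
    ∃ (r : ℕ) (k : ℤ), r.Prime ∧ r ≠ p ∧ (ℓ : ℤ) ∣ r - 2 ∧ a + ℓ * M * k * b = ℓ ^ j * r := by
  have haMb : IsCoprime a (M * b) := haM.mul_right hab
  have hlMb : IsCoprime (ℓ : ℤ) (M * b) := haMb.of_isCoprime_of_dvd_left hla
  obtain ⟨u, v, huv⟩ := hlMb.pow_left (m := j + 1)
  have hu : IsCoprime u (M * b) := ⟨ℓ ^ (j + 1), v, by linear_combination huv⟩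
  obtain ⟨y, z, hyz⟩ := id hlMb
  -- Chinese remainder theorem: `r₀ ≡ 2` modulo `ℓ`, and `r₀ ≡ a u ℓ` modulo `M b`, where `u ℓ` is
  -- an inverse of `ℓ ^ j`.
  set r₀ : ℤ := a * (u * ℓ) * (y * ℓ) + 2 * (z * (M * b)) with hr₀
  have hr₀l : (ℓ : ℤ) ∣ r₀ - 2 := ⟨a * (u * ℓ) * y - 2 * y, by rw [hr₀]; linear_combination 2 * hyz⟩
  have hr₀M : M * b ∣ r₀ - a * (u * ℓ) :=
    ⟨2 * z - a * (u * ℓ) * z, by rw [hr₀]; linear_combination a * (u * ℓ) * hyz⟩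
  have hc1 : IsCoprime r₀ ℓ := by
    obtain ⟨c, hc⟩ := hr₀l
    have h2 : IsCoprime (2 : ℤ) ℓ := by
      have := (Nat.coprime_primes Nat.prime_two hl).2 hl2.ne
      exact_mod_cast Nat.isCoprime_iff_coprime.2 this
    rw [show r₀ = 2 + ℓ * c by linear_combination hc]
    exact h2.add_mul_left_left c
  have hc2 : IsCoprime r₀ (M * b) := by
    obtain ⟨c, hc⟩ := hr₀M
    rw [show r₀ = a * (u * ℓ) + M * b * c by linear_combination hc]
    exact (haMb.mul_left (hu.mul_left ⟨y, z, hyz⟩)).add_mul_left_left c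
  have hq0 : (ℓ * (M * b)).natAbs ≠ 0 := by
    simp [hl.ne_zero, hM, hb]
  have hcop : IsCoprime r₀ ((ℓ * (M * b)).natAbs : ℤ) := by
    rw [Int.natCast_natAbs, IsCoprime.abs_right_iff]
    exact hc1.mul_right hc2
  obtain ⟨r, hrp, hr, hrmod⟩ := Nat.forall_exists_prime_gt_and_zmodEq p hq0 hcop
  have hdvd : (ℓ : ℤ) * (M * b) ∣ r - r₀ := by
    have := hrmod.symm.dvd
    rwa [Int.natCast_natAbs, abs_dvd] at this
  have hrl : (ℓ : ℤ) ∣ r - 2 := by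
    have h1 : (ℓ : ℤ) ∣ r - r₀ := (dvd_mul_right _ _).trans hdvd
    rw [show (r : ℤ) - 2 = (r - r₀) + (r₀ - 2) by ring]
    exact h1.add hr₀l
  have hrM : M * b ∣ ℓ ^ j * r - a := by
    have h1 : M * b ∣ (r : ℤ) - a * (u * ℓ) := by
      rw [show (r : ℤ) - a * (u * ℓ) = (r - r₀) + (r₀ - a * (u * ℓ)) by ring]
      exact ((dvd_mul_left _ _).trans hdvd).add hr₀M
    have h2 : M * b ∣ ℓ ^ j * (a * (u * ℓ)) - a := ⟨- a * v, by linear_combination a * huv⟩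
    rw [show (ℓ : ℤ) ^ j * r - a = ℓ ^ j * (r - a * (u * ℓ)) + (ℓ ^ j * (a * (u * ℓ)) - a) by ring]
    exact (h1.mul_left _).add h2
  have hlj : (ℓ : ℤ) ∣ ℓ ^ j * r - a := ((dvd_pow_self _ hj).mul_right _).sub hla
  obtain ⟨k, hk⟩ := hlMb.mul_dvd hlj hrM
  exact ⟨r, k, hr, hrp.ne', hrl, by linear_combination -hk⟩

end Arithmetic

/-! ### Unipotent and diagonal elements of the amalgam. -/

section Elements

variable {p : ℕ}

/-- The upper unipotent matrix `(1 x; 0 1)`. -/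
def upp (x : ZInv p) : GL (Fin 2) (ZInv p) := mk2 1 x 0 1 (by ring)

/-- The lower unipotent matrix `(1 0; x 1)`. -/
def low (x : ZInv p) : GL (Fin 2) (ZInv p) := mk2 1 0 x 1 (by ring)

theorem pow_mul_pInv_pow (n : ℕ) : (p : ZInv p) ^ n * pInv p ^ n = 1 := by
  rw [← mul_pow, mul_pInv, one_pow]

/-- The diagonal matrix `(p ^ n, p ^ (-n))`. -/
def tor (p n : ℕ) : GL (Fin 2) (ZInv p) :=
  mk2 ((p : ZInv p) ^ n) 0 0 (pInv p ^ n) (by rw [pow_mul_pInv_pow]; ring)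

theorem upp_add (x y : ZInv p) : upp (x + y) = upp x * upp y := by
  rw [upp, upp, upp, mk2_mul]
  apply mk2_congr <;> ring

theorem low_add (x y : ZInv p) : low (x + y) = low x * low y := by
  rw [low, low, low, mk2_mul]
  apply mk2_congr <;> ring

theorem tor_eq_pow (n : ℕ) : tor p n = tor p 1 ^ n := by
  induction n with
  | zero => rw [pow_zero, ← mk2_one]; apply mk2_congr <;> simp
  | succ n ih =>
    rw [pow_succ, ← ih, tor, tor, tor, mk2_mul]
    apply mk2_congr <;> ring

theorem tor_mul_upp (n : ℕ) (x : ZInv p) :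
    tor p n * upp x = upp ((p : ZInv p) ^ (2 * n) * x) * tor p n := by
  rw [tor, upp, upp, mk2_mul, mk2_mul]
  apply mk2_congr <;> try ring1
  rw [two_mul, pow_add]
  linear_combination (-(p : ZInv p) ^ n * x) * pow_mul_pInv_pow (p := p) n

theorem tor_mul_low (n : ℕ) (x : ZInv p) :
    tor p n * low x = low (pInv p ^ (2 * n) * x) * tor p n := by
  rw [tor, low, low, mk2_mul, mk2_mul]
  apply mk2_congr <;> try ring1
  rw [two_mul, pow_add]
  linear_combination (-(pInv p) ^ n * x) * pow_mul_pInv_pow (p := p) n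

theorem exists_eq_pInv_pow_mul (x : ZInv p) : ∃ (n : ℕ) (y : ℤ), (p : ZInv p) ^ n * x = y := by
  obtain ⟨n, a, h⟩ := IsLocalization.Away.surj (p : ℤ) x
  exact ⟨n, a, by rw [mul_comm]; simpa using h⟩

variable {M : ℕ}

/-- The subgroup generated by the two factors of the amalgam. -/
def amalgam (p M : ℕ) : Subgroup (GL (Fin 2) (ZInv p)) := ⨆ i, factor p M i

theorem Gamma0_le_amalgam : Gamma0 p M ≤ amalgam p M := le_iSup (factor p M) true

theorem Gamma0'_le_amalgam : Gamma0' p M ≤ amalgam p M := le_iSup (factor p M) false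

/-- A Bézout relation `p x + M y = 1` factors `diag(p, p⁻¹)` as an element of `Γ₀(M)` times one of
`Γ₀(M)'`. Conjugation by its powers then brings in all unipotents with denominators. -/
theorem tor_mem (hp : p.Prime) (hpM : ¬ p ∣ M) (n : ℕ) : tor p n ∈ amalgam p M := by
  rw [tor_eq_pow]
  refine pow_mem ?_ n
  have hcop : IsCoprime (p : ℤ) M :=
    Nat.isCoprime_iff_coprime.2 ((Nat.Prime.coprime_iff_not_dvd hp).2 hpM)
  obtain ⟨x, y, hxy⟩ := hcop
  have h1 : (p : ℤ) * x - (-1) * (M * y) = 1 := by linear_combination hxy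
  have h2 : (p : ℤ) * x * 1 - 1 * (M * (-y)) = 1 := by linear_combination hxy
  have h3 : tor p 1 = mkZ p p (-1) (M * y) x h1 *
      mk2 ((p * x : ℤ) : ZInv p) ((1 : ℤ) * pInv p) (p * (M * (-y) : ℤ)) (1 : ℤ) (det_conj h2) := by
    have h4 := congrArg (Int.cast : ℤ → ZInv p) hxy
    push_cast at h4
    rw [tor, mkZ, mk2_mul]
    apply mk2_congr <;> push_cast
    · linear_combination -(p : ZInv p) * h4
    · linear_combination -mul_pInv p
    · ring
    · linear_combination -pInv p * h4 + (x : ZInv p) * mul_pInv p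
  rw [h3]
  exact mul_mem (Gamma0_le_amalgam (mkZ_mem h1 (dvd_mul_right _ _)))
    (Gamma0'_le_amalgam (mem_Gamma0'_iff.2 ⟨_, _, _, _, h2, rfl⟩))

theorem upp_intCast (x : ℤ) : upp (x : ZInv p) = mkZ p 1 x 0 1 (by ring) := by
  apply mk2_congr <;> simp

theorem low_intCast (x : ℤ) : low (x : ZInv p) = mkZ p 1 0 x 1 (by ring) := by
  apply mk2_congr <;> simp

theorem upp_int_mem (x : ℤ) : upp (x : ZInv p) ∈ Gamma0 p M := by
  rw [upp_intCast]
  exact mkZ_mem _ (dvd_zero _)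

theorem low_int_mem (x : ℤ) : low ((M : ZInv p) * (x : ZInv p)) ∈ Gamma0 p M := by
  have : ((M : ZInv p) * (x : ZInv p)) = ((M * x : ℤ) : ZInv p) := by push_cast; rfl
  rw [this, low_intCast]
  exact mkZ_mem _ (dvd_mul_right _ _)

theorem upp_mem (hp : p.Prime) (hpM : ¬ p ∣ M) (x : ZInv p) : upp x ∈ amalgam p M := by
  obtain ⟨n, y, hy⟩ := exists_eq_pInv_pow_mul x
  have h := tor_mul_upp n x
  rw [two_mul, pow_add, mul_assoc, hy] at h
  rw [eq_inv_mul_iff_mul_eq.2 h]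
  have := upp_int_mem (p := p) (M := M) ((p : ℤ) ^ n * y)
  push_cast at this
  exact mul_mem (inv_mem (tor_mem hp hpM n)) (mul_mem (Gamma0_le_amalgam this) (tor_mem hp hpM n))

theorem low_mem (hp : p.Prime) (hpM : ¬ p ∣ M) (x : ZInv p) : low ((M : ZInv p) * x) ∈ amalgam p M := by
  obtain ⟨n, y, hy⟩ := exists_eq_pInv_pow_mul x
  have h := tor_mul_low n ((M : ZInv p) * ((p : ZInv p) ^ n * (y : ZInv p)))
  have h2 : pInv p ^ (2 * n) * (M * ((p : ZInv p) ^ n * (y : ZInv p))) = M * x := by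
    rw [← hy, two_mul, pow_add]
    linear_combination (M * x * ((p : ZInv p) ^ n * pInv p ^ n + 1)) * pow_mul_pInv_pow (p := p) n
  rw [h2] at h
  rw [← mul_inv_eq_iff_eq_mul.2 h]
  have := low_int_mem (p := p) (M := M) ((p : ℤ) ^ n * y)
  push_cast at this
  exact mul_mem (mul_mem (tor_mem hp hpM n) (Gamma0_le_amalgam this)) (inv_mem (tor_mem hp hpM n))

/-- Conjugation by a diagonal matrix agrees with elementary operations when `P ^ 2 - 1` is
divisible by the upper left corner. -/
theorem diag_mul_mk2 {R : Type*} [CommRing R] {P q a b c d m : R} (hP : P * q = 1)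
    (h : a * d - b * c = 1) (hm : P ^ 2 - 1 = a * m) :
    mk2 P 0 0 q (by linear_combination hP) * mk2 a b c d h =
      mk2 1 0 (-(q ^ 2 * m * c)) 1 (by ring) * mk2 a b c d h * mk2 1 (m * b) 0 1 (by ring) *
        mk2 P 0 0 q (by linear_combination hP) := by
  rw [mk2_mul, mk2_mul, mk2_mul, mk2_mul]
  apply mk2_congr
  · ring
  · linear_combination q * b * hm - P * b * hP
  · linear_combination -q ^ 2 * P * c * hm - c * q * hP + c * P * (P * q + 1) * hP
  · linear_combination q * b * m * c * (-q ^ 2 * hm + (P * q + 1) * hP)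

theorem tor_mul_mkZ {a b c d m : ℤ} (h : a * d - b * c = 1) {n : ℕ}
    (hm : (p : ℤ) ^ (2 * n) - 1 = a * m) :
    tor p n * mkZ p a b c d h =
      low (-(pInv p ^ (2 * n) * (m : ZInv p) * (c : ZInv p))) * mkZ p a b c d h *
        upp ((m : ZInv p) * (b : ZInv p)) * tor p n := by
  have hm' := congrArg (Int.cast : ℤ → ZInv p) hm
  push_cast at hm'
  rw [mul_comm 2 n, pow_mul] at hm' ⊢
  exact diag_mul_mk2 (pow_mul_pInv_pow n) (intDet h) hm'

end Elements

/-! ### The representation on unipotent and diagonal elements. -/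

section Action

variable {F : Type u} [Field F] {p : ℕ} (w : ℕ) (hpF : IsUnit (p : F))

theorem rep_mk2_apply {a b c d : ZInv p} (h : a * d - b * c = 1) (P : V F w) :
    (rep w hpF (mk2 a b c d h) P : F[X]) =
      slash w !![toF hpF d, -toF hpF b; -toF hpF c, toF hpF a] P := by
  change slash w (((Matrix.GeneralLinearGroup.map (toF hpF) (mk2 a b c d h))⁻¹ :
    GL (Fin 2) F) : Matrix (Fin 2) (Fin 2) F) (P : F[X]) = _
  rw [← map_inv, mk2_inv]
  congr 1
  congr 1
  ext i j
  fin_cases i <;> fin_cases j <;> simp [mk2]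

theorem rep_congr {a b c d a' b' c' d' : ZInv p} (h : a * d - b * c = 1)
    (h' : a' * d' - b' * c' = 1) (ha : toF hpF a = toF hpF a') (hb : toF hpF b = toF hpF b')
    (hc : toF hpF c = toF hpF c') (hd : toF hpF d = toF hpF d') :
    rep w hpF (mk2 a b c d h) = rep w hpF (mk2 a' b' c' d' h') := by
  ext1 P
  exact Subtype.ext (by rw [rep_mk2_apply, rep_mk2_apply, ha, hb, hc, hd])

theorem rep_upp_apply (x : ZInv p) (P : V F w) :
    (rep w hpF (upp x) P : F[X]) = slash w !![1, -toF hpF x; 0, 1] P := by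
  simp [upp, rep_mk2_apply]

theorem rep_low_apply (x : ZInv p) (P : V F w) :
    (rep w hpF (low x) P : F[X]) = slash w !![1, 0; -toF hpF x, 1] P := by
  simp [low, rep_mk2_apply]

theorem rep_upp_congr {x y : ZInv p} (h : toF hpF x = toF hpF y) :
    rep w hpF (upp x) = rep w hpF (upp y) :=
  rep_congr w hpF _ _ rfl h rfl rfl

theorem rep_low_congr {x y : ZInv p} (h : toF hpF x = toF hpF y) :
    rep w hpF (low x) = rep w hpF (low y) :=
  rep_congr w hpF _ _ rfl rfl h rfl

theorem toF_pInv : toF hpF (pInv p) = (p : F)⁻¹ := by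
  have := congrArg (toF hpF) (mul_pInv p)
  rw [map_mul, map_natCast, map_one] at this
  exact (inv_eq_of_mul_eq_one_right this).symm

theorem rep_tor_eq_one {n : ℕ} (hn : (p : F) ^ n = 1) : rep w hpF (tor p n) = 1 := by
  rw [← map_one (rep w hpF), ← mk2_one]
  refine rep_congr w hpF _ _ ?_ rfl rfl ?_
  · rw [map_pow, map_natCast, hn, map_one]
  · rw [map_pow, toF_pInv, inv_pow, hn, inv_one, map_one]

variable {w}

theorem eq_C_of_rep_upp_eq {ℓ : ℕ} [CharP F ℓ] (hw : w < ℓ) {P : V F w} {x : ZInv p}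
    (hx : toF hpF x ≠ 0) (h : rep w hpF (upp x) P = P) : (P : F[X]) = C ((P : F[X]).coeff 0) := by
  refine eq_C_of_slash_upper_eq hw P.2 (neg_ne_zero.2 hx) ?_
  rw [← rep_upp_apply, h]

theorem exists_eq_of_rep_low_eq {ℓ : ℕ} [CharP F ℓ] (hw : w < ℓ) {P : V F w} {x : ZInv p}
    (hx : toF hpF x ≠ 0) (h : rep w hpF (low x) P = P) : ∃ c, (P : F[X]) = C c * X ^ w := by
  refine exists_eq_of_slash_lower_eq hw P.2 (neg_ne_zero.2 hx) ?_
  rw [← rep_low_apply, h]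

theorem eq_zero_of_eq_C_of_eq_monomial (hw0 : w ≠ 0) {P : F[X]} {c : F} (h1 : P = C (P.coeff 0))
    (h2 : P = C c * X ^ w) : P = 0 := by
  have h3 : P.coeff 0 = 0 := by
    rw [h2]
    simp [coeff_X_pow, hw0.symm]
  rw [h1, h3, C_0]

theorem exists_eq_mul_of_toF_eq_zero {ℓ : ℕ} [CharP F ℓ] {x : ZInv p} (h : toF hpF x = 0) :
    ∃ y : ZInv p, x = ℓ * y := by
  obtain ⟨n, y, hy⟩ := exists_eq_pInv_pow_mul x
  have h2 := congrArg (toF hpF) hy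
  rw [map_mul, h, mul_zero, map_intCast, eq_comm, CharP.intCast_eq_zero_iff F ℓ] at h2
  obtain ⟨z, rfl⟩ := h2
  refine ⟨pInv p ^ n * (z : ZInv p), ?_⟩
  push_cast at hy
  linear_combination pInv p ^ n * hy - x * pow_mul_pInv_pow (p := p) n

theorem toF_char {ℓ : ℕ} [CharP F ℓ] (x : ZInv p) : toF hpF (ℓ * x) = 0 := by
  rw [map_mul, map_natCast, CharP.cast_eq_zero, zero_mul]

end Action

/-! ### Cocycles along a one-parameter unipotent subgroup. -/

section OneParameter

variable {F : Type u} [Field F] {p : ℕ} {hpF : IsUnit (p : F)} {w : ℕ}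
  {Γ : Subgroup (GL (Fin 2) (ZInv p))} {φ : GL (Fin 2) (ZInv p) → V F w}
  (hφ : IsCocycleOn (rep w hpF) Γ φ)
  {e : ZInv p → GL (Fin 2) (ZInv p)} (hadd : ∀ x y, e (x + y) = e x * e y)
  (hmem : ∀ x, e x ∈ Γ)
  (hcongr : ∀ x y, toF hpF x = toF hpF y → rep w hpF (e x) = rep w hpF (e y))
  {ℓ : ℕ} [CharP F ℓ]

include hadd in
theorem oneParam_zero : e 0 = 1 := by
  have := hadd 0 0
  rwa [add_zero, left_eq_mul] at this

include hadd hcongr in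
theorem rep_oneParam_char_mul (x : ZInv p) : rep w hpF (e (ℓ * x)) = 1 := by
  rw [hcongr (ℓ * x) 0 (by rw [toF_char, map_zero]), oneParam_zero hadd, map_one]

include hφ hadd hmem hcongr

theorem cocycle_oneParam_add (x y : ZInv p) :
    φ (e (ℓ * x + y)) = φ (e (ℓ * x)) + φ (e y) := by
  rw [hadd, hφ _ (hmem _) _ (hmem _), rep_oneParam_char_mul hadd hcongr, Module.End.one_apply]

/-- Since `e (ℓ x)` acts trivially, `x ↦ φ (e (ℓ x))` is additive; clearing the denominator of `x`
by a power of `p`, which is invertible in `F`, makes it linear. -/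
theorem cocycle_oneParam_char_mul (x : ZInv p) :
    φ (e (ℓ * x)) = toF hpF x • φ (e ℓ) := by
  let α : ZInv p →+ V F w := AddMonoidHom.mk' (fun x => φ (e (ℓ * x))) fun x y => by
    rw [mul_add, cocycle_oneParam_add hφ hadd hmem hcongr]
  obtain ⟨n, y, hy⟩ := exists_eq_pInv_pow_mul x
  have h1 : (p : F) ^ n • α x = (y : F) • α 1 := by
    rw [Int.cast_smul_eq_zsmul F y (α 1), ← map_zsmul, zsmul_one, ← hy, ← Nat.cast_pow,
      Nat.cast_smul_eq_nsmul F (p ^ n) (α x), ← map_nsmul, nsmul_eq_mul, Nat.cast_pow]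
  have h2 := congrArg (toF hpF) hy
  rw [map_mul, map_pow, map_natCast, map_intCast] at h2
  have h3 : (p : F) ^ n • α x = (p : F) ^ n • toF hpF x • α 1 := by
    rw [h1, smul_smul, h2]
  have h4 := smul_right_injective (V F w) (pow_ne_zero n hpF.ne_zero) h3
  simpa [α] using h4

/-- The elements `e x` and `e ℓ` commute and `e ℓ` acts trivially; the claim follows by expanding
the cocycle on their product in both orders. -/
theorem rep_cocycle_oneParam_char (x : ZInv p) :
    rep w hpF (e x) (φ (e ℓ)) = φ (e ℓ) := by
  have h1 := hφ _ (hmem ℓ) _ (hmem x)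
  have h2 := hφ _ (hmem x) _ (hmem ℓ)
  rw [← hadd, add_comm, hadd, h2] at h1
  have h3 := rep_oneParam_char_mul (ℓ := ℓ) hadd hcongr (1 : ZInv p)
  rw [mul_one] at h3
  rw [h3, Module.End.one_apply, add_comm] at h1
  exact add_right_cancel h1

omit hcongr in
theorem cocycle_oneParam_natCast (n : ℕ) :
    φ (e n) = ∑ i ∈ Finset.range n, rep w hpF (e i) (φ (e 1)) := by
  induction n with
  | zero => rw [Nat.cast_zero, oneParam_zero hadd, hφ.map_one, Finset.sum_range_zero]
  | succ n ih =>
    rw [Finset.sum_range_succ, ← ih, Nat.cast_succ, hadd, hφ _ (hmem _) _ (hmem _)]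

theorem cocycle_oneParam_congr (h0 : φ (e ℓ) = 0) {x y : ZInv p} (h : toF hpF x = toF hpF y) :
    φ (e x) = φ (e y) := by
  obtain ⟨z, hz⟩ := exists_eq_mul_of_toF_eq_zero (ℓ := ℓ) hpF (x := x - y)
    (by rw [map_sub, h, sub_self])
  rw [show x = ℓ * z + y by linear_combination hz, cocycle_oneParam_add hφ hadd hmem hcongr,
    cocycle_oneParam_char_mul hφ hadd hmem hcongr, h0, smul_zero, zero_add]

/-- If `T` acts trivially and conjugates `e x` to `e (x + ℓ ^ 2 z)`, then the value of the cocycle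
at `T` is fixed by `e x`. -/
theorem rep_oneParam_cocycle_eq {T : GL (Fin 2) (ZInv p)} (hT : T ∈ Γ)
    (hT1 : rep w hpF T = 1) {x z : ZInv p} (h : T * e x = e (ℓ * (ℓ * z) + x) * T) :
    rep w hpF (e x) (φ T) = φ T := by
  have h1 := hφ _ hT _ (hmem x)
  have h2 := hφ _ (hmem (ℓ * (ℓ * z) + x)) _ hT
  -- The factor `ℓ ^ 2` is what kills the shift: its value is `toF (ℓ z) • φ (e ℓ) = 0`, with no
  -- knowledge of `φ (e ℓ)`.
  rw [h, h2, cocycle_oneParam_add hφ hadd hmem hcongr,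
    cocycle_oneParam_char_mul hφ hadd hmem hcongr, toF_char, zero_smul, zero_add, hT1,
    Module.End.one_apply, add_comm, hcongr (ℓ * (ℓ * z) + x) x (by rw [map_add, toF_char, zero_add])] at h1
  exact add_right_cancel h1

end OneParameter

/-- The integer `q` is chosen before `a` and `b`: the quotient of `p ^ (2n) - 1` by the modified
corner is `ℓ ^ i m` with `m ≡ q / 2` modulo `ℓ` uniformly. The case `i = 1` serves to kill the
values at unipotents with parameter `ℓ`, the case `i = 0` the comparison of congruent matrices. -/
theorem exists_special_corner {p ℓ M : ℕ} (hp : p.Prime) (hl : ℓ.Prime) (hl5 : 5 ≤ ℓ)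
    (hlp : ℓ ≠ p) (hM : M ≠ 0) :
    ∃ q : ℤ, ¬ (ℓ : ℤ) ∣ q ∧ ∀ i ≤ 1, ∀ a b : ℤ, (ℓ : ℤ) ∣ a → IsCoprime a b →
      IsCoprime a (M : ℤ) → b ≠ 0 → ∃ (k : ℤ) (n : ℕ) (m z : ℤ),
        (p : ℤ) ^ (2 * n) - 1 = (a + ℓ * M * k * b) * (ℓ ^ i * m) ∧ (ℓ : ℤ) ∣ p ^ n - 1 ∧
          (ℓ : ℤ) ∣ 2 * m - q ∧ (p : ℤ) ^ (2 * n) - 1 = ℓ * (ℓ * z) := by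
  obtain ⟨N, E, q, hE, hN, hq, hlq⟩ := exists_pow_eq_one_add hp hl hlp
  refine ⟨q, hlq, fun i hi a b hla hab haM hb => ?_⟩
  -- The corner becomes `ℓ ^ (E - i) r`, so dividing `ℓ ^ E r m` by it leaves `ℓ ^ i m`; the
  -- exponent is positive because `i ≤ 1 < E`.
  obtain ⟨r, k, hr, hrp, hrl, hk⟩ := exists_prime_corner (p := p) hl (by omega)
    (j := E - i) (by omega) hla hab haM (by exact_mod_cast hM) hb
  obtain ⟨n, m, hn, hm, hmq⟩ := exists_pow_sub_one_eq hp hl (by omega) hE hN hq hr hrp hrl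
  have hEi : (ℓ : ℤ) ^ E = ℓ ^ (E - i) * ℓ ^ i := by rw [← pow_add, Nat.sub_add_cancel (by omega)]
  have hE2 : (ℓ : ℤ) ^ E = ℓ * ℓ * ℓ ^ (E - 2) := by
    rw [← pow_two, ← pow_add, Nat.add_sub_cancel' hE]
  refine ⟨k, n, m, ℓ ^ (E - 2) * (r * m), ?_, dvd_pow_sub_one hl hp hlp hn, hmq, ?_⟩
  · rw [hm, hk, hEi]; ring
  · rw [hm, hE2]; ring

/-! ### Vanishing on the torus, and the relation obtained from conjugation by it. -/

section Vanishing

variable {F : Type u} [Field F] {ℓ w p M : ℕ} [CharP F ℓ] {hpF : IsUnit (p : F)}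
  (hp : p.Prime) (hpM : ¬ p ∣ M) (hl : ℓ.Prime) (hl5 : 5 ≤ ℓ) (hlp : ℓ ≠ p) (hlM : ¬ ℓ ∣ M)
  (hw : w < ℓ) (hw0 : w ≠ 0)
  {φ : GL (Fin 2) (ZInv p) → V F w} (hφ : IsCocycleOn (rep w hpF) (amalgam p M) φ)

theorem low_mul_add (x y : ZInv p) :
    low ((M : ZInv p) * (x + y)) = low ((M : ZInv p) * x) * low ((M : ZInv p) * y) := by
  rw [mul_add, low_add]

theorem rep_low_mul_congr (x y : ZInv p) (h : toF hpF x = toF hpF y) :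
    rep w hpF (low ((M : ZInv p) * x)) = rep w hpF (low ((M : ZInv p) * y)) :=
  rep_low_congr w hpF (by rw [map_mul, map_mul, h])

theorem rep_upp_congr' (x y : ZInv p) (h : toF hpF x = toF hpF y) :
    rep w hpF (upp x) = rep w hpF (upp y) := rep_upp_congr w hpF h

include hlM in
theorem level_ne_zero : (M : F) ≠ 0 := by
  rwa [Ne, CharP.cast_eq_zero_iff F ℓ]

include hp hpM hφ

include hl in
theorem cocycle_upp_char_eq_zero_of_lt (hwl : w + 1 < ℓ) : φ (upp (ℓ : ZInv p)) = 0 := by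
  have : Fact ℓ.Prime := ⟨hl⟩
  rw [cocycle_oneParam_natCast hφ upp_add (upp_mem hp hpM)]
  refine Subtype.ext ?_
  rw [AddSubmonoidClass.coe_finsetSum, ZeroMemClass.coe_zero]
  rw [← sum_slash_upper_eq_zero hwl (φ (upp 1)).2 (-1)]
  refine Finset.sum_congr rfl fun i _ => ?_
  rw [rep_upp_apply, map_natCast, mul_neg_one]

include hl in
theorem cocycle_low_char_eq_zero_of_lt (hwl : w + 1 < ℓ) :
    φ (low ((M : ZInv p) * (ℓ : ZInv p))) = 0 := by
  have : Fact ℓ.Prime := ⟨hl⟩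
  have h := cocycle_oneParam_natCast (e := fun x => low ((M : ZInv p) * x)) hφ low_mul_add
    (low_mem hp hpM) ℓ
  rw [h]
  refine Subtype.ext ?_
  rw [AddSubmonoidClass.coe_finsetSum, ZeroMemClass.coe_zero]
  rw [← sum_slash_lower_eq_zero hwl (-(M : F)) (φ (low ((M : ZInv p) * 1)))]
  refine Finset.sum_congr rfl fun i _ => ?_
  rw [rep_low_apply, map_mul, map_natCast, map_natCast]
  congr 2
  rw [mul_comm, mul_neg]

-- The torus element acts trivially and moves unipotent parameters by multiples of `ℓ ^ 2`, so its
-- value is fixed by an upper and by a lower unipotent. It is thus both a constant and a multiple of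
-- `X ^ w`, hence zero as `w ≠ 0`.
include hlM hw hw0 in
theorem cocycle_tor_eq_zero {n : ℕ} (hn : (p : F) ^ n = 1) {z : ℤ}
    (hz : (p : ℤ) ^ (2 * n) - 1 = ℓ * (ℓ * z)) : φ (tor p n) = 0 := by
  have hz' := congrArg (Int.cast : ℤ → ZInv p) hz
  push_cast at hz'
  have hT := tor_mem hp hpM n
  have hT1 := rep_tor_eq_one w hpF hn
  have hU := rep_oneParam_cocycle_eq (ℓ := ℓ) hφ upp_add (upp_mem hp hpM) rep_upp_congr' hT hT1
    (x := 1) (z := (z : ZInv p)) (by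
      rw [tor_mul_upp, mul_one, ← hz', sub_add_cancel])
  have hL := rep_oneParam_cocycle_eq (ℓ := ℓ) (e := fun x => low ((M : ZInv p) * x)) hφ low_mul_add
    (low_mem hp hpM) rep_low_mul_congr hT hT1 (x := 1) (z := -(pInv p ^ (2 * n) * (z : ZInv p))) (by
      rw [tor_mul_low]
      congr 2
      linear_combination (M : ZInv p) * pow_mul_pInv_pow (p := p) (2 * n)
        - (M : ZInv p) * pInv p ^ (2 * n) * hz')
  have h1 := eq_C_of_rep_upp_eq hpF hw (x := 1) (by rw [map_one]; exact one_ne_zero) hU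
  obtain ⟨c, h2⟩ := exists_eq_of_rep_low_eq hpF hw (by
    rw [mul_one, map_natCast]; exact level_ne_zero hlM) hL
  exact Subtype.ext (eq_zero_of_eq_C_of_eq_monomial hw0 h1 h2)

/-- The relation between the values of a cocycle at the corner `γ` and at unipotent elements. -/
theorem cocycle_relation {a b c d m : ℤ} (h : a * d - b * (M * c) = 1) {n : ℕ}
    (hm : (p : ℤ) ^ (2 * n) - 1 = a * m) (hn : (p : F) ^ n = 1) (hT : φ (tor p n) = 0) :
    φ (mkZ p a b (M * c) d h) =
      φ (low ((M : ZInv p) * -(pInv p ^ (2 * n) * (m : ZInv p) * (c : ZInv p)))) +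
      rep w hpF (low ((M : ZInv p) * -(pInv p ^ (2 * n) * (m : ZInv p) * (c : ZInv p))))
        (φ (mkZ p a b (M * c) d h) +
          rep w hpF (mkZ p a b (M * c) d h) (φ (upp ((m : ZInv p) * (b : ZInv p))))) := by
  have hrel := tor_mul_mkZ (p := p) h hm
  have hx : -(pInv p ^ (2 * n) * (m : ZInv p) * ((M * c : ℤ) : ZInv p)) =
      (M : ZInv p) * -(pInv p ^ (2 * n) * (m : ZInv p) * (c : ZInv p)) := by push_cast; ring
  rw [hx] at hrel
  set x := -(pInv p ^ (2 * n) * (m : ZInv p) * (c : ZInv p))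
  have hγ : mkZ p a b (M * c) d h ∈ amalgam p M :=
    Gamma0_le_amalgam (mkZ_mem h (dvd_mul_right _ _))
  set γ := mkZ p a b (M * c) d h
  have hTm := tor_mem hp hpM n
  have hl := low_mem hp hpM x
  have hu := upp_mem hp hpM ((m : ZInv p) * (b : ZInv p))
  have h1 := congrArg φ hrel
  rw [hφ _ hTm _ hγ, hT, rep_tor_eq_one w hpF hn, zero_add, Module.End.one_apply,
    hφ _ (mul_mem (mul_mem hl hγ) hu) _ hTm, hT, map_zero, add_zero,
    hφ _ (mul_mem hl hγ) _ hu, hφ _ hl _ hγ, map_mul, Module.End.mul_apply, add_assoc,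
    ← map_add] at h1
  exact h1

end Vanishing

/-! ### The action of integral matrices depends only on residues. -/

section IntegralAction

variable {F : Type u} [Field F] {p : ℕ} (w : ℕ) (hpF : IsUnit (p : F))

theorem rep_mkZ_apply {a b c d : ℤ} (h : a * d - b * c = 1) (P : V F w) :
    (rep w hpF (mkZ p a b c d h) P : F[X]) = slash w !![(d : F), -b; -c, a] P := by
  rw [mkZ, rep_mk2_apply]
  simp only [map_intCast]

theorem rep_mkZ_congr {a b c d a' b' c' d' : ℤ} (h : a * d - b * c = 1)
    (h' : a' * d' - b' * c' = 1) (ha : (a : F) = a') (hb : (b : F) = b') (hc : (c : F) = c')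
    (hd : (d : F) = d') : rep w hpF (mkZ p a b c d h) = rep w hpF (mkZ p a' b' c' d' h') := by
  refine rep_congr w hpF _ _ ?_ ?_ ?_ ?_ <;> simpa only [map_intCast]

theorem intCast_eq_of_dvd {ℓ : ℕ} [CharP F ℓ] {a b : ℤ} (h : (ℓ : ℤ) ∣ a - b) : (a : F) = b := by
  rw [← sub_eq_zero, ← Int.cast_sub]
  exact (CharP.intCast_eq_zero_iff F ℓ _).2 h

theorem toF_pInv_pow {n : ℕ} (hn : (p : F) ^ n = 1) : toF hpF (pInv p ^ (2 * n)) = 1 := by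
  rw [map_pow, toF_pInv, mul_comm, pow_mul, inv_pow, hn, inv_one, one_pow]

theorem mkZ_mul_low {M : ℕ} {a b c d : ℤ} (h : a * d - b * (M * c) = 1) (k : ℤ) :
    mkZ p a b (M * c) d h * low ((M : ZInv p) * (k : ZInv p)) =
      mkZ p (a + M * k * b) b (M * (c + k * d)) d (by linear_combination h) := by
  have : (M : ZInv p) * (k : ZInv p) = ((M * k : ℤ) : ZInv p) := by push_cast; rfl
  rw [this, low_intCast, mkZ_mul]
  apply mkZ_congr <;> ring

end IntegralAction

/-! ### Vanishing at unipotents with parameter `ℓ`. -/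

section Vanishing

variable {F : Type u} [Field F] {ℓ w p M : ℕ} [CharP F ℓ] {hpF : IsUnit (p : F)}
  (hp : p.Prime) (hpM : ¬ p ∣ M) (hl : ℓ.Prime) (hl5 : 5 ≤ ℓ) (hlp : ℓ ≠ p) (hlM : ¬ ℓ ∣ M)
  (hw : w < ℓ) (hw0 : w ≠ 0)
  {φ : GL (Fin 2) (ZInv p) → V F w} (hφ : IsCocycleOn (rep w hpF) (amalgam p M) φ)

include hp hpM hl hl5 hlp hlM hw hw0 hφ

/-- In the borderline weight the power sums no longer vanish. The two values are still invariant
under unipotents, hence given by scalars `α` and `β`, and a matrix with upper right entry `b` links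
these. The dependence on `b` is what later forces `α = β = 0`. -/
theorem cocycle_char_relation (hwl : w + 1 = ℓ) {b : ℤ} (hb0 : b ≠ 0) (hbl : IsCoprime (ℓ : ℤ) b) :
    ∃ α β : F, (φ (upp (ℓ : ZInv p)) : F[X]) = C α ∧
      (φ (low ((M : ZInv p) * (ℓ : ZInv p))) : F[X]) = C β * X ^ w ∧ -β = M * b ^ 2 * α := by
  have hU := rep_cocycle_oneParam_char (ℓ := ℓ) hφ upp_add (upp_mem hp hpM) rep_upp_congr' 1
  have hL := rep_cocycle_oneParam_char (ℓ := ℓ) (e := fun x => low ((M : ZInv p) * x)) hφ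
    low_mul_add (low_mem hp hpM) rep_low_mul_congr 1
  have hα := eq_C_of_rep_upp_eq hpF hw (by rw [map_one]; exact one_ne_zero) hU
  obtain ⟨β, hβ⟩ := exists_eq_of_rep_low_eq hpF hw (by
    rw [mul_one, map_natCast]; exact level_ne_zero hlM) hL
  refine ⟨_, β, hα, hβ, ?_⟩
  set α := (φ (upp (ℓ : ZInv p)) : F[X]).coeff 0
  have hlF : (ℓ : F) = 0 := CharP.cast_eq_zero F ℓ
  have hMl : IsCoprime (ℓ : ℤ) M :=
    Nat.isCoprime_iff_coprime.2 ((Nat.Prime.coprime_iff_not_dvd hl).2 hlM)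
  obtain ⟨x, y, hxy⟩ := hbl.mul_right hMl
  have h : (ℓ * x) * 1 - b * (M * (-y)) = 1 := by linear_combination hxy
  obtain ⟨q, hq, hspecial⟩ := exists_special_corner hp hl hl5 hlp
    (M := M) (by rintro rfl; exact hlM (dvd_zero _))
  -- Taking `i = 1` puts a factor `ℓ` in both unipotent parameters, so the value at `γ` cancels and
  -- only `α` and `β` remain.
  obtain ⟨k, n, m, z, hm, hn, hmq, hz⟩ := hspecial 1 le_rfl (ℓ * x) b (dvd_mul_right _ _)
    ⟨1, M * y, by linear_combination hxy⟩ ⟨1, b * y, by linear_combination hxy⟩ hb0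
  have hnF : (p : F) ^ n = 1 := by
    have := intCast_eq_of_dvd (F := F) hn
    exact_mod_cast this
  have hT := cocycle_tor_eq_zero hp hpM hlM hw hw0 hφ hnF hz
  have h1 : (ℓ * x + ℓ * M * k * b) * 1 - b * (M * (-y + ℓ * k)) = 1 := by
    linear_combination h
  have hrel := cocycle_relation hp hpM hφ h1 hm hnF hT
  set c := -y + ℓ * k with hc
  set γ := mkZ p (ℓ * x + ℓ * M * k * b) b (M * c) 1 h1
  have e1 : (M : ZInv p) * -(pInv p ^ (2 * n) * ((ℓ ^ 1 * m : ℤ) : ZInv p) * (c : ZInv p)) =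
      (M : ZInv p) * ((ℓ : ZInv p) * -(pInv p ^ (2 * n) * (m : ZInv p) * (c : ZInv p))) := by
    push_cast; ring
  have e2 : ((ℓ ^ 1 * m : ℤ) : ZInv p) * (b : ZInv p) =
      (ℓ : ZInv p) * ((m : ZInv p) * (b : ZInv p)) := by push_cast; ring
  rw [e1, e2] at hrel
  have e3 := rep_oneParam_char_mul (ℓ := ℓ) (hpF := hpF) (w := w)
    (e := fun x => low ((M : ZInv p) * x)) low_mul_add rep_low_mul_congr
    (-(pInv p ^ (2 * n) * (m : ZInv p) * (c : ZInv p)))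
  have e4 := cocycle_oneParam_char_mul (ℓ := ℓ) (e := fun x => low ((M : ZInv p) * x)) hφ
    low_mul_add (low_mem hp hpM) rep_low_mul_congr
    (-(pInv p ^ (2 * n) * (m : ZInv p) * (c : ZInv p)))
  rw [e3, e4, cocycle_oneParam_char_mul hφ upp_add (upp_mem hp hpM) rep_upp_congr',
    Module.End.one_apply, add_left_comm, left_eq_add, map_smul] at hrel
  have hcoeff := congrArg (fun P : V F w => (P : F[X]).coeff w) hrel
  have hF := congrArg (Int.cast : ℤ → F) hxy
  push_cast at hF
  rw [hlF, mul_zero, zero_add] at hF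
  have hcF : (c : F) = -y := by rw [hc]; push_cast; rw [hlF]; ring
  have hfermat : ((y : F) * M) ^ w = 1 := by
    have hcop : IsCoprime (y * M : ℤ) ℓ := ⟨b, x, by linear_combination hxy⟩
    have h2 := (Int.ModEq.pow_card_sub_one_eq_one hl hcop).symm.dvd
    have h3 := intCast_eq_of_dvd (F := F) h2
    rw [← hwl, Nat.add_sub_cancel] at h3
    exact_mod_cast h3
  simp only [Submodule.coe_add, Submodule.coe_smul, coeff_add, coeff_smul, ZeroMemClass.coe_zero,
    coeff_zero, map_neg, map_mul, toF_pInv_pow hpF hnF, map_intCast, one_mul, smul_eq_mul] at hcoeff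
  rw [hβ, rep_mkZ_apply, hα, slash_const, coeff_C_mul, coeff_C_mul, coeff_X_pow_self] at hcoeff
  have hpow : ((C (-((M * c : ℤ) : F)) * X + C ((ℓ * x + ℓ * M * k * b : ℤ) : F)) ^ w).coeff w =
      1 := by
    push_cast
    rw [hlF, zero_mul, zero_mul, zero_mul, zero_mul, add_zero, C_0, add_zero, mul_pow, ← C_pow,
      coeff_C_mul, coeff_X_pow_self, hcF, mul_one, mul_neg, neg_neg, mul_comm, hfermat]
  have hcoeff' : -((m : F) * c) * (β * 1) + m * b * (α * 1) = 0 :=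
    (congrArg (fun t => -((m : F) * c) * (β * 1) + m * b * (α * t)) hpow.symm).trans hcoeff
  rw [hcF] at hcoeff'
  have hm0 : (m : F) ≠ 0 := by
    intro hm0
    rw [CharP.intCast_eq_zero_iff F ℓ] at hm0
    exact hq (by simpa using (hm0.mul_left 2).sub hmq)
  have h5 : (m : F) * (y * β + b * α) = 0 := by linear_combination hcoeff'
  have h6 := (mul_eq_zero.1 h5).resolve_left hm0
  linear_combination (-b * M : F) * h6 + (β) * hF

/-- For `w + 1 < ℓ` the norm of a unipotent is zero on `V`. For `w + 1 = ℓ` the relations for `b =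
1` and `b = 2` differ by `(2 ^ 2 - 1 ^ 2) M α = 0`, and `3 M` is invertible since `ℓ ≥ 5` and `ℓ ∤
M`. -/
theorem cocycle_char_eq_zero :
    φ (upp (ℓ : ZInv p)) = 0 ∧ φ (low ((M : ZInv p) * (ℓ : ZInv p))) = 0 := by
  rcases (Nat.succ_le_of_lt hw).lt_or_eq with hwl | hwl
  · exact ⟨cocycle_upp_char_eq_zero_of_lt hp hpM hl hφ hwl,
      cocycle_low_char_eq_zero_of_lt hp hpM hl hφ hwl⟩
  · have h2 : IsCoprime (ℓ : ℤ) 2 := by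
      have := (Nat.coprime_primes hl Nat.prime_two).2 (by omega)
      exact_mod_cast Nat.isCoprime_iff_coprime.2 this
    obtain ⟨α, β, hα, hβ, h⟩ := cocycle_char_relation hp hpM hl hl5 hlp hlM hw hw0 hφ hwl
      one_ne_zero isCoprime_one_right
    obtain ⟨α', β', hα', hβ', h'⟩ := cocycle_char_relation hp hpM hl hl5 hlp hlM hw hw0 hφ
      hwl two_ne_zero h2
    obtain rfl : α = α' := C_injective (hα.symm.trans hα')
    obtain rfl : β = β' := by
      simpa using congrArg (fun P : F[X] => P.coeff w) (hβ.symm.trans hβ')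
    have h3 : (3 : F) ≠ 0 := by
      intro h3
      have : ((3 : ℕ) : F) = 0 := by exact_mod_cast h3
      rw [CharP.cast_eq_zero_iff F ℓ] at this
      have := Nat.le_of_dvd (by norm_num) this
      omega
    have hM := level_ne_zero (F := F) hlM
    have hα0 : α = 0 := by
      have : (3 * M : F) * α = 0 := by push_cast at h h'; linear_combination h - h'
      exact (mul_eq_zero.1 this).resolve_left (mul_ne_zero h3 hM)
    have hβ0 : β = 0 := by rw [hα0] at h; linear_combination -h
    exact ⟨Subtype.ext (by rw [hα, hα0, C_0]; rfl), Subtype.ext (by rw [hβ, hβ0, C_0, zero_mul]; rfl)⟩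

end Vanishing

/-! ### On `Γ₀(M)` a cocycle depends only on residues modulo `ℓ`. -/

section Vanishing

variable {F : Type u} [Field F] {ℓ w p M : ℕ} [CharP F ℓ] {hpF : IsUnit (p : F)}
  (hp : p.Prime) (hpM : ¬ p ∣ M) (hl : ℓ.Prime) (hl5 : 5 ≤ ℓ) (hlp : ℓ ≠ p) (hlM : ¬ ℓ ∣ M)
  (hw : w < ℓ) (hw0 : w ≠ 0)
  {φ : GL (Fin 2) (ZInv p) → V F w} (hφ : IsCocycleOn (rep w hpF) (amalgam p M) φ)

include hp hpM hl hl5 hlp hlM hw hw0 hφ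

/-- A relation for the value of a cocycle at `γ` whose coefficients depend only on `γ` modulo
`ℓ`. -/
theorem exists_corner_relation : ∃ q : F, q ≠ 0 ∧ ∀ {a b c d : ℤ}
    (h : a * d - b * (M * c) = 1), (a : F) = 0 → ∃ x z : ZInv p,
      toF hpF x = q * c ∧ toF hpF z = -q * b ∧ φ (mkZ p a b (M * c) d h) =
        φ (low ((M : ZInv p) * x)) + rep w hpF (low ((M : ZInv p) * x))
        (φ (mkZ p a b (M * c) d h) + rep w hpF (mkZ p a b (M * c) d h) (φ (upp z))) := by
  obtain ⟨hU0, hL0⟩ := cocycle_char_eq_zero hp hpM hl hl5 hlp hlM hw hw0 hφ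
  obtain ⟨q, hq, hspecial⟩ := exists_special_corner hp hl hl5 hlp
    (M := M) (by rintro rfl; exact hlM (dvd_zero _))
  have h2 : (2 : F) ≠ 0 := by
    intro h2
    have : ((2 : ℕ) : F) = 0 := by exact_mod_cast h2
    rw [CharP.cast_eq_zero_iff F ℓ] at this
    have := Nat.le_of_dvd (by norm_num) this
    omega
  have hlF : (ℓ : F) = 0 := CharP.cast_eq_zero F ℓ
  have hq0 : (q : F) ≠ 0 := by rwa [Ne, CharP.intCast_eq_zero_iff F ℓ]
  refine ⟨-(q / 2), neg_ne_zero.2 (div_ne_zero hq0 h2), fun {a b c d} h ha => ?_⟩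
  have hla : (ℓ : ℤ) ∣ a := (CharP.intCast_eq_zero_iff F ℓ a).1 ha
  have hb : b ≠ 0 := by
    rintro rfl
    rw [zero_mul, sub_zero] at h
    have h1 : (ℓ : ℤ) ∣ 1 := h ▸ hla.mul_right d
    exact (Nat.prime_iff_prime_int.1 hl).not_dvd_one h1
  -- Right multiplication by a lower unipotent with parameter `ℓ M k` produces the special corner;
  -- it changes neither the value of `φ`, by the vanishing at `low (M ℓ)`, nor the action.
  obtain ⟨k, n, m, z, hm, hn, hmq, hz⟩ := hspecial 0 zero_le_one a b hla
    ⟨d, -(M * c), by linear_combination h⟩ ⟨d, -(b * c), by linear_combination h⟩ hb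
  rw [pow_zero, one_mul] at hm
  have hnF : (p : F) ^ n = 1 := by
    have := intCast_eq_of_dvd (F := F) hn
    exact_mod_cast this
  have hmF : (m : F) = q / 2 := by
    have := intCast_eq_of_dvd (F := F) hmq
    push_cast at this
    rw [← this]
    field_simp
  have hT := cocycle_tor_eq_zero hp hpM hlM hw hw0 hφ hnF hz
  have hmul := mkZ_mul_low (p := p) h (ℓ * k)
  have h1 : (a + ℓ * M * k * b) * d - b * (M * (c + ℓ * k * d)) = 1 := by
    linear_combination h
  rw [mkZ_congr (h' := h1) (by ring) rfl rfl rfl] at hmul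
  have hγ : mkZ p a b (M * c) d h ∈ amalgam p M :=
    Gamma0_le_amalgam (mkZ_mem h (dvd_mul_right _ _))
  have hφγ : φ (mkZ p (a + ℓ * M * k * b) b (M * (c + ℓ * k * d)) d h1) =
      φ (mkZ p a b (M * c) d h) := by
    have e4 := cocycle_oneParam_char_mul (ℓ := ℓ) (e := fun x => low ((M : ZInv p) * x)) hφ
      low_mul_add (low_mem hp hpM) rep_low_mul_congr (k : ZInv p)
    have e5 : ((ℓ * k : ℤ) : ZInv p) = (ℓ : ZInv p) * (k : ZInv p) := by push_cast; rfl
    rw [← hmul, hφ _ hγ _ (low_mem hp hpM _), e5, e4, hL0, smul_zero, map_zero, add_zero]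
  have hργ : rep w hpF (mkZ p (a + ℓ * M * k * b) b (M * (c + ℓ * k * d)) d h1) =
      rep w hpF (mkZ p a b (M * c) d h) := by
    refine rep_mkZ_congr w hpF _ _ ?_ rfl ?_ rfl
    · push_cast; rw [hlF]; ring
    · push_cast; rw [hlF]; ring
  have hrel := cocycle_relation hp hpM hφ h1 hm hnF hT
  rw [hφγ, hργ] at hrel
  refine ⟨_, _, ?_, ?_, hrel⟩
  · simp only [map_neg, map_mul, toF_pInv_pow hpF hnF, map_intCast, hmF]
    push_cast
    rw [hlF]
    ring
  · simp only [map_mul, map_intCast, hmF]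
    ring

/-- Both values solve the same inhomogeneous equation, because its coefficients depend only on
residues. Their difference is fixed by a lower unipotent, which is nontrivial since `a ≡ 0` and the
determinant is `1`. -/
theorem cocycle_sub_eq_monomial {a b c d a' b' c' d' : ℤ} (h : a * d - b * (M * c) = 1)
    (h' : a' * d' - b' * (M * c') = 1) (ha0 : (a : F) = 0) (ha : (a : F) = a') (hb : (b : F) = b')
    (hc : (c : F) = c') (hd : (d : F) = d') :
    ∃ t : F, ((φ (mkZ p a b (M * c) d h) - φ (mkZ p a' b' (M * c') d' h') : V F w) : F[X]) =
      C t * X ^ w := by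
  obtain ⟨hU0, hL0⟩ := cocycle_char_eq_zero hp hpM hl hl5 hlp hlM hw hw0 hφ
  obtain ⟨q, hq, hrel⟩ := exists_corner_relation hp hpM hl hl5 hlp hlM hw hw0 hφ
  obtain ⟨x, z, hx, hz, h1⟩ := hrel h ha0
  obtain ⟨x', z', hx', hz', h1'⟩ := hrel h' (ha ▸ ha0)
  have hxx : toF hpF x' = toF hpF x := by rw [hx, hx', hc]
  have hzz : toF hpF z' = toF hpF z := by rw [hz, hz', hb]
  have e1 := cocycle_oneParam_congr (ℓ := ℓ) (e := fun x => low ((M : ZInv p) * x)) hφ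
      low_mul_add (low_mem hp hpM) rep_low_mul_congr hL0 hxx
  have e2 := cocycle_oneParam_congr (ℓ := ℓ) hφ upp_add (upp_mem hp hpM) rep_upp_congr' hU0 hzz
  rw [e1, e2, rep_low_mul_congr _ _ hxx,
    ← rep_mkZ_congr w hpF h h' ha hb (by push_cast; rw [hc]) hd] at h1'
  refine exists_eq_of_rep_low_eq hpF hw (x := (M : ZInv p) * x) ?_ ?_
  · have hdet := congrArg (Int.cast : ℤ → F) h
    push_cast at hdet
    rw [ha0] at hdet
    rw [map_mul, hx, map_natCast]
    refine mul_ne_zero (level_ne_zero hlM) (mul_ne_zero hq ?_)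
    intro hc0
    rw [hc0] at hdet
    simp at hdet
  · conv_rhs => rw [h1, h1']
    simp only [map_sub, map_add]
    abel

/-- A cocycle is a constant polynomial at elements which are trivial modulo `ℓ`. -/
theorem cocycle_eq_C {a b c d : ℤ} (h : a * d - b * (M * c) = 1) (ha : (a : F) = 1)
    (hb : (b : F) = 0) (hc : (c : F) = 0) (hd : (d : F) = 1) :
    ∃ t : F, (φ (mkZ p a b (M * c) d h) : F[X]) = C t := by
  have hlF : (ℓ : F) = 0 := CharP.cast_eq_zero F ℓ
  have hMl : IsCoprime (ℓ : ℤ) M :=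
    Nat.isCoprime_iff_coprime.2 ((Nat.Prime.coprime_iff_not_dvd hl).2 hlM)
  obtain ⟨x, y, hxy⟩ := hMl
  have hγ : (x * ℓ) * 1 - 1 * (M * (-y)) = 1 := by linear_combination hxy
  have hF := congrArg (Int.cast : ℤ → F) hxy
  push_cast at hF
  rw [hlF, mul_zero, zero_add] at hF
  -- Multiplying on the left by a `γ` with corner divisible by `ℓ` gives a matrix congruent to `γ`,
  -- so `γ` maps the value sought to a multiple of `X ^ w`. The inverse of `γ` turns `X ^ w` into
  -- `(0 X + 1) ^ w = 1`.
  have hmul : mkZ p (x * ℓ) 1 (M * (-y)) 1 hγ * mkZ p a b (M * c) d h =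
      mkZ p (x * ℓ * a + M * c) (x * ℓ * b + d) (M * (-y * a + c)) (M * (-y) * b + d)
        (by linear_combination h + (a * d - b * (M * c)) * hxy) := by
    rw [mkZ_mul]
    apply mkZ_congr <;> ring
  obtain ⟨t, ht⟩ := cocycle_sub_eq_monomial hp hpM hl hl5 hlp hlM hw hw0 hφ
    (show (x * ℓ * a + M * c) * (M * (-y) * b + d) - (x * ℓ * b + d) * (M * (-y * a + c)) = 1 by
      linear_combination h + (a * d - b * (M * c)) * hxy) hγ
    (by push_cast; rw [hlF, hc]; ring) (by push_cast; rw [hlF, hc]; ring)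
    (by push_cast; rw [hlF, hd]; ring) (by push_cast; rw [ha, hc]; ring)
    (by push_cast; rw [hb, hd]; ring)
  rw [← hmul, hφ _ (Gamma0_le_amalgam (mkZ_mem hγ (dvd_mul_right _ _))) _
    (Gamma0_le_amalgam (mkZ_mem h (dvd_mul_right _ _))), add_sub_cancel_left, rep_mkZ_apply] at ht
  have hinv := congrArg (slash w !![((x * ℓ : ℤ) : F), (1 : ℤ); ((M * -y : ℤ) : F), (1 : ℤ)]) ht
  rw [← slash_mul, slash_monomial] at hinv
  refine ⟨t, ?_⟩
  have e1 : !![((1 : ℤ) : F), -((1 : ℤ) : F); -((M * -y : ℤ) : F), ((x * ℓ : ℤ) : F)] *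
      !![((x * ℓ : ℤ) : F), (1 : ℤ); ((M * -y : ℤ) : F), (1 : ℤ)] = 1 := by
    rw [Matrix.mul_fin_two, Matrix.one_fin_two]
    push_cast
    rw [hlF]
    congr! <;> first | ring1 | linear_combination hF
  rw [e1, slash_one (φ _).2] at hinv
  rw [hinv]
  change C t * (C ((x * ℓ : ℤ) : F) * X + C ((1 : ℤ) : F)) ^ w = C t
  push_cast
  rw [hlF]
  simp

/-- A cocycle vanishes at elements which are trivial modulo `ℓ`. -/
theorem cocycle_eq_zero_of_trivial {a b c d : ℤ} (h : a * d - b * (M * c) = 1) (ha : (a : F) = 1)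
    (hb : (b : F) = 0) (hc : (c : F) = 0) (hd : (d : F) = 1) :
    φ (mkZ p a b (M * c) d h) = 0 := by
  have hκmem : mkZ p a b (M * c) d h ∈ amalgam p M :=
    Gamma0_le_amalgam (mkZ_mem h (dvd_mul_right _ _))
  have hκ1 : rep w hpF (mkZ p a b (M * c) d h) = 1 := by
    rw [← map_one (rep w hpF), ← mk2_one]
    refine rep_congr w hpF _ _ ?_ ?_ ?_ ?_ <;> simp [ha, hb, hc, hd]
  obtain ⟨t, ht⟩ := cocycle_eq_C hp hpM hl hl5 hlp hlM hw hw0 hφ h ha hb hc hd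
  have h2 : (a - M * b) * (d + M * b) - b * (M * (c + a - M * b - d)) = 1 := by
    linear_combination h
  -- The conjugate is again trivial modulo `ℓ`, so the lower unipotent carries the constant `t` to a
  -- constant; but the image has leading coefficient `t (-M) ^ w`.
  have hconj : low ((M : ZInv p) * 1) * mkZ p a b (M * c) d h =
      mkZ p (a - M * b) b (M * (c + a - M * b - d)) (d + M * b) h2 * low ((M : ZInv p) * 1) := by
    have e : (M : ZInv p) * 1 = ((M : ℤ) : ZInv p) := by push_cast; ring
    rw [e, low_intCast, mkZ_mul, mkZ_mul]
    apply mkZ_congr <;> ring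
  obtain ⟨t', ht'⟩ := cocycle_eq_C hp hpM hl hl5 hlp hlM hw hw0 hφ h2
    (by push_cast; rw [ha, hb]; ring) hb (by push_cast; rw [ha, hb, hc, hd]; ring)
    (by push_cast; rw [hb, hd]; ring)
  have hκ'1 : rep w hpF (mkZ p (a - M * b) b (M * (c + a - M * b - d)) (d + M * b) h2) = 1 := by
    rw [← map_one (rep w hpF), ← mk2_one]
    refine rep_congr w hpF _ _ ?_ ?_ ?_ ?_ <;> simp [ha, hb, hc, hd]
  have hlow := low_mem hp hpM (1 : ZInv p)
  have h3 := congrArg φ hconj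
  rw [hφ _ hlow _ hκmem, hφ _ (Gamma0_le_amalgam (mkZ_mem h2 (dvd_mul_right _ _))) _ hlow, hκ'1,
    Module.End.one_apply, add_comm] at h3
  have h4 := congrArg (fun P : V F w => (P : F[X]).coeff w) (add_right_cancel h3)
  simp only [rep_low_apply, ht, ht', slash_const] at h4
  have h5 : ((C (-toF hpF ((M : ZInv p) * 1)) * X + C (1 : F)) ^ w).coeff w = (-(M : F)) ^ w := by
    rw [coeff_linear_pow, mul_one, map_natCast]
  rw [coeff_C_of_ne_zero hw0, coeff_C_mul] at h4
  have h6 : t * (-(M : F)) ^ w = 0 := by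
    rw [← h5]
    exact h4
  have h7 : t = 0 := (mul_eq_zero.1 h6).resolve_right
    (pow_ne_zero _ (neg_ne_zero.2 (level_ne_zero hlM)))
  exact Subtype.ext (by rw [ht, h7, C_0]; rfl)

/-- The value of a cocycle at an element of `Γ₀(M)` depends only on the element modulo `ℓ`. -/
theorem cocycle_congr {a b c d a' b' c' d' : ℤ} (h : a * d - b * (M * c) = 1)
    (h' : a' * d' - b' * (M * c') = 1) (ha : (a : F) = a') (hb : (b : F) = b')
    (hc : (c : F) = c') (hd : (d : F) = d') :
    φ (mkZ p a b (M * c) d h) = φ (mkZ p a' b' (M * c') d' h') := by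
  have hdet := congrArg (Int.cast : ℤ → F) h
  push_cast at hdet
  have h2 : (d * a' - b * M * c') * (-c * M * b' + a * d') -
      (d * b' - b * d') * (M * (-c * a' + a * c')) = 1 := by
    linear_combination h' + (a' * d' - b' * (M * c')) * h
  have hmul : mkZ p a' b' (M * c') d' h' = mkZ p a b (M * c) d h *
      mkZ p (d * a' - b * M * c') (d * b' - b * d') (M * (-c * a' + a * c'))
        (-c * M * b' + a * d') h2 := by
    rw [mkZ_mul]
    apply mkZ_congr
    · linear_combination -a' * h
    · linear_combination -b' * h
    · linear_combination -M * c' * h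
    · linear_combination -d' * h
  rw [hmul, hφ _ (Gamma0_le_amalgam (mkZ_mem h (dvd_mul_right _ _))) _
    (Gamma0_le_amalgam (mkZ_mem h2 (dvd_mul_right _ _))),
    cocycle_eq_zero_of_trivial hp hpM hl hl5 hlp hlM hw hw0 hφ h2, map_zero, add_zero]
  · push_cast; rw [← ha, ← hc]; linear_combination hdet
  · push_cast; rw [← hb, ← hd]; ring
  · push_cast; rw [← ha, ← hc]; ring
  · push_cast; rw [← hb, ← hd]; linear_combination hdet

end Vanishing

/-! ### The leading coefficient of the value at `(1 1; 0 1)`. -/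

section Coboundary

variable {F : Type u} [Field F] {ℓ w p M : ℕ} [CharP F ℓ] {hpF : IsUnit (p : F)}

instance finiteDimensional_V (w : ℕ) : FiniteDimensional F (V F w) := by
  have h : V F w = degreeLT F (w + 1) := by
    ext P
    rw [mem_V_iff, mem_degreeLT, degree_lt_iff_coeff_zero, natDegree_le_iff_coeff_eq_zero]
    rfl
  rw [h]
  infer_instance

/-- The leading coefficient of a polynomial of degree at most `w`. -/
def topCoeff (w : ℕ) : V F w →ₗ[F] F := (lcoeff F w).comp (V F w).subtype

theorem topCoeff_apply (P : V F w) : topCoeff w P = (P : F[X]).coeff w := rfl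

variable (hpF) in
theorem topCoeff_rep_upp (x : ZInv p) (P : V F w) :
    topCoeff w (rep w hpF (upp x) P) = topCoeff w P := by
  rw [topCoeff_apply, rep_upp_apply, coeff_slash_of_lower_left_eq_zero, one_pow, one_mul,
    topCoeff_apply]

-- The image of `upp 1 - 1` lies in the kernel of `topCoeff`; as only constants are fixed, both
-- spaces have codimension one and so coincide.
variable (hpF) in
theorem exists_rep_upp_sub_eq (hw : w < ℓ) {P : V F w} (hP : topCoeff w P = 0) :
    ∃ Q, rep w hpF (upp 1) Q - Q = P := by
  let D : V F w →ₗ[F] V F w := rep w hpF (upp 1) - LinearMap.id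
  have hle : LinearMap.range D ≤ LinearMap.ker (topCoeff (F := F) w) := by
    rintro _ ⟨Q, rfl⟩
    rw [LinearMap.mem_ker]
    simp [D, topCoeff_rep_upp]
  have hker : Module.finrank F (LinearMap.ker D) ≤ 1 := by
    refine finrank_le_one (⟨⟨1, mem_V_iff.2 (by simp)⟩, ?_⟩) ?_
    · rw [LinearMap.mem_ker]
      refine Subtype.ext ?_
      simp only [D, LinearMap.sub_apply, LinearMap.id_apply, AddSubgroupClass.coe_sub,
        rep_upp_apply, ZeroMemClass.coe_zero]
      rw [← C_1, slash_const]
      simp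
    · rintro ⟨Q, hQ⟩
      have hQ' : rep w hpF (upp 1) Q = Q := by
        rw [LinearMap.mem_ker] at hQ
        exact sub_eq_zero.1 hQ
      have h := eq_C_of_rep_upp_eq hpF hw (by rw [map_one]; exact one_ne_zero) hQ'
      refine ⟨(Q : F[X]).coeff 0, Subtype.ext (Subtype.ext ?_)⟩
      simp only [SetLike.mk_smul_mk]
      rw [h, smul_eq_C_mul, mul_one, coeff_C_zero]
  have hrange : LinearMap.range (topCoeff (F := F) w) = ⊤ := by
    refine LinearMap.range_eq_top.2 fun c => ?_
    refine ⟨⟨C c * X ^ w, mem_V_iff.2 (natDegree_C_mul_X_pow_le c w)⟩, ?_⟩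
    simp [topCoeff_apply]
  have h1 := LinearMap.finrank_range_add_finrank_ker D
  have h2 := LinearMap.finrank_range_add_finrank_ker (topCoeff (F := F) w)
  rw [hrange, finrank_top, Module.finrank_self] at h2
  have heq := Submodule.eq_of_le_of_finrank_le hle (by omega)
  have hmem : P ∈ LinearMap.range D := heq ▸ LinearMap.mem_ker.2 hP
  exact hmem

variable (hp : p.Prime) (hpM : ¬ p ∣ M) (hl : ℓ.Prime) (hl5 : 5 ≤ ℓ) (hlp : ℓ ≠ p) (hlM : ¬ ℓ ∣ M)
  (hw : w < ℓ) (hw0 : w ≠ 0)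
  {φ : GL (Fin 2) (ZInv p) → V F w} (hφ : IsCocycleOn (rep w hpF) (amalgam p M) φ)

section

include hp hpM hφ

theorem topCoeff_cocycle_upp (n : ℕ) :
    topCoeff w (φ (upp (n : ZInv p))) = n * topCoeff w (φ (upp 1)) := by
  rw [cocycle_oneParam_natCast hφ upp_add (upp_mem hp hpM), map_sum]
  simp [topCoeff_rep_upp]

include hl hl5 hlp hlM hw hw0

/-- For `γ ≡ diag(n, n⁻¹)` modulo `ℓ`, the elements `γ · upp 1` and `upp (n ^ 2) · γ` are congruent.
Comparing leading coefficients gives `n ^ (-w) τ = n ^ 2 τ` for the invariant `τ`, so `τ = 0` as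
soon as some `n` has `n ^ (w + 2) ≠ 1`. -/
theorem topCoeff_eq_zero (hne : ℓ ≠ w + 3) : topCoeff w (φ (upp 1)) = 0 := by
  have : Fact ℓ.Prime := ⟨hl⟩
  obtain ⟨x, hx⟩ : ∃ x : (ZMod ℓ)ˣ, x ^ (w + 2) ≠ 1 := by
    by_contra! hall
    have h := (FiniteField.forall_pow_eq_one_iff (ZMod ℓ) (w + 2)).1 hall
    rw [ZMod.card] at h
    obtain ⟨k, hk⟩ := h
    obtain ⟨m, rfl⟩ : ∃ m, ℓ = m + 5 := ⟨ℓ - 5, by omega⟩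
    -- Since `0 < w + 2 ≤ ℓ + 1 < 2 (ℓ - 1)`, divisibility by `ℓ - 1` would leave only the excluded
    -- equality `w + 2 = ℓ - 1`.
    rcases k with _ | _ | k
    · omega
    · omega
    · have : (m + 5 - 1) * (k + 1 + 1) = (m + 4) * k + 2 * (m + 4) := by
        rw [show m + 5 - 1 = m + 4 by omega]; ring
      have : 0 ≤ (m + 4) * k := Nat.zero_le _
      omega
  have hMl : IsCoprime (ℓ : ℤ) M :=
    Nat.isCoprime_iff_coprime.2 ((Nat.Prime.coprime_iff_not_dvd hl).2 hlM)
  obtain ⟨t, s, hts⟩ := hMl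
  set n : ℕ := (x : ZMod ℓ).val
  have hnl : IsCoprime (n : ℤ) ℓ := Nat.isCoprime_iff_coprime.2 (ZMod.val_coe_unit_coprime x)
  -- Congruent to `n` modulo `ℓ` and to `1` modulo `M`, so that it is the corner of a matrix in
  -- `Γ₀(M)` that is diagonal modulo `ℓ`.
  set a : ℤ := n * (s * M) + t * ℓ with ha
  have hlF : (ℓ : F) = 0 := CharP.cast_eq_zero F ℓ
  have hF := congrArg (Int.cast : ℤ → F) hts
  push_cast at hF
  rw [hlF, mul_zero, zero_add] at hF
  have haF : (a : F) = n := by rw [ha]; push_cast; rw [hlF, hF]; ring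
  have hal : IsCoprime a ℓ := by
    have : a = n + ℓ * (t - n * t) := by rw [ha]; linear_combination n * hts
    rw [this]
    exact hnl.add_mul_left_left _
  have haM : IsCoprime a M := by
    have : a = 1 + M * (n * s - s) := by rw [ha]; linear_combination hts
    rw [this]
    exact isCoprime_one_left.add_mul_left_left _
  obtain ⟨d, c, hdc⟩ := (hal.mul_right hal).mul_right haM
  have hγ : a * d - ℓ * (M * (-(ℓ * c))) = 1 := by linear_combination hdc
  have hadF := congrArg (Int.cast : ℤ → F) hγ
  push_cast at hadF
  rw [hlF, zero_mul, sub_zero] at hadF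
  have e1 : mkZ p a ℓ (M * (-(ℓ * c))) d hγ * upp 1 = mkZ p a (a + ℓ) (M * (-(ℓ * c)))
      (M * (-(ℓ * c)) + d) (by linear_combination hγ) := by
    have : (1 : ZInv p) = ((1 : ℤ) : ZInv p) := by simp
    rw [this, upp_intCast, mkZ_mul]
    apply mkZ_congr <;> ring
  have e2 : upp ((n ^ 2 : ℕ) : ZInv p) * mkZ p a ℓ (M * (-(ℓ * c))) d hγ =
      mkZ p (a + n ^ 2 * (M * (-(ℓ * c)))) (ℓ + n ^ 2 * d) (M * (-(ℓ * c))) d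
        (by linear_combination hγ) := by
    have : ((n ^ 2 : ℕ) : ZInv p) = ((n ^ 2 : ℤ) : ZInv p) := by push_cast; rfl
    rw [this, upp_intCast, mkZ_mul]
    apply mkZ_congr <;> ring
  have hmem := Gamma0_le_amalgam (mkZ_mem (p := p) hγ (dvd_mul_right _ _))
  have h1 := cocycle_congr (F := F) hp hpM hl hl5 hlp hlM hw hw0 hφ
    (show a * (M * (-(ℓ * c)) + d) - (a + ℓ) * (M * (-(ℓ * c))) = 1 by linear_combination hγ)
    (show (a + n ^ 2 * (M * (-(ℓ * c)))) * d - (ℓ + n ^ 2 * d) * (M * (-(ℓ * c))) = 1 by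
      linear_combination hγ)
    (by push_cast; rw [hlF]; ring)
    (by push_cast; rw [hlF, ← haF]; linear_combination -(a : F) * hadF)
    rfl (by push_cast; rw [hlF]; ring)
  rw [← e1, ← e2, hφ _ hmem _ (upp_mem hp hpM _), hφ _ (upp_mem hp hpM _) _ hmem] at h1
  have h2 := congrArg (topCoeff w) h1
  rw [map_add, map_add, topCoeff_rep_upp, topCoeff_cocycle_upp hp hpM hφ, add_comm,
    topCoeff_apply (rep w hpF (mkZ p a ℓ (M * (-(ℓ * c))) d hγ) _), rep_mkZ_apply] at h2
  have h3 : -((M * (-(ℓ * c)) : ℤ) : F) = 0 := by push_cast; rw [hlF]; ring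
  rw [h3, coeff_slash_of_lower_left_eq_zero, ← topCoeff_apply] at h2
  have h4 := add_right_cancel h2
  by_contra h0
  have h5 : (d : F) ^ w = n ^ 2 := by
    have := mul_right_cancel₀ h0 h4
    exact_mod_cast this
  have h6 : (n : F) ^ (w + 2) = 1 := by
    rw [pow_add, ← h5, ← mul_pow, ← haF, hadF, one_pow]
  refine hx (Units.ext ?_)
  rw [Units.val_pow_eq_pow_val, Units.val_one, ← ZMod.natCast_zmod_val (x : ZMod ℓ)]
  have h7 : ((n ^ (w + 2) : ℕ) : F) = (1 : ℕ) := by push_cast; exact h6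
  rw [CharP.natCast_eq_natCast F ℓ] at h7
  have h8 := (ZMod.natCast_eq_natCast_iff _ _ _).2 h7
  push_cast at h8
  exact h8

end

end Coboundary

/-- Every nonzero vector modulo `ℓ` is the first column of an element of `Γ₀(M)`. -/
theorem exists_matrix_with_column {ℓ M : ℕ} (hl : ℓ.Prime) (hlM : ¬ ℓ ∣ M) (v : ZMod ℓ × ZMod ℓ)
    (hv : v ≠ 0) : ∃ a b c d : ℤ, a * d - b * (M * c) = 1 ∧ (a : ZMod ℓ) = v.1 ∧
      (M * c : ZMod ℓ) = v.2 := by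
  have : Fact ℓ.Prime := ⟨hl⟩
  have hM : (M : ZMod ℓ) ≠ 0 := by rwa [Ne, ZMod.natCast_eq_zero_iff]
  obtain ⟨n, m, k, h1, h2⟩ : ∃ n m k : ZMod ℓ, 1 + m * M * n = v.1 ∧
      M * (n + k * (1 + m * M * n)) = v.2 := by
    by_cases hy : v.2 = 0
    · have hx : v.1 ≠ 0 := fun hx => hv (Prod.ext hx hy)
      have e : 1 + (v.1 - 1) * M * (M : ZMod ℓ)⁻¹ = v.1 := by field_simp; ring
      refine ⟨(M : ZMod ℓ)⁻¹, v.1 - 1, -(M * v.1)⁻¹, e, ?_⟩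
      rw [e, hy]
      field_simp
      ring
    · refine ⟨v.2 / M, (v.1 - 1) / v.2, 0, ?_, ?_⟩
      · field_simp; ring
      · field_simp; ring
  obtain ⟨n, rfl⟩ := ZMod.intCast_surjective n
  obtain ⟨m, rfl⟩ := ZMod.intCast_surjective m
  obtain ⟨k, rfl⟩ := ZMod.intCast_surjective k
  refine ⟨1 + m * M * n, m, n + k * (1 + m * M * n), 1 + M * k * m, by ring, ?_, ?_⟩
  · rw [← h1]; push_cast; ring
  · rw [← h2]; push_cast; ring

theorem intCast_eq_of_zmod {F : Type u} [Field F] {ℓ : ℕ} [CharP F ℓ] {a b : ℤ}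
    (h : (a : ZMod ℓ) = b) : (a : F) = b := by
  rw [CharP.intCast_eq_intCast F ℓ, ← ZMod.intCast_eq_intCast_iff]
  exact h

/-! ### Averaging over the nonzero vectors modulo `ℓ`. -/

section Coboundary

variable {F : Type u} [Field F] {ℓ w p M : ℕ} [CharP F ℓ] {hpF : IsUnit (p : F)}
  (hp : p.Prime) (hpM : ¬ p ∣ M) (hl : ℓ.Prime) (hl5 : 5 ≤ ℓ) (hlp : ℓ ≠ p) (hlM : ¬ ℓ ∣ M)
  (hw : w < ℓ) (hw0 : w ≠ 0)
  {φ : GL (Fin 2) (ZInv p) → V F w} (hφ : IsCocycleOn (rep w hpF) (amalgam p M) φ)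

include hp hpM hl hl5 hlp hlM hw hw0 hφ

/-- Two matrices with the same first column modulo `ℓ` differ there by an upper unipotent on the
right, where the cocycle vanishes. -/
theorem cocycle_eq_of_column_eq (h1 : φ (upp 1) = 0) {a b c d a' b' c' d' : ℤ}
    (h : a * d - b * (M * c) = 1) (h' : a' * d' - b' * (M * c') = 1)
    (ha : (a : F) = a') (hc : (c : F) = c') :
    φ (mkZ p a b (M * c) d h) = φ (mkZ p a' b' (M * c') d' h') := by
  obtain ⟨hU0, -⟩ := cocycle_char_eq_zero hp hpM hl hl5 hlp hlM hw hw0 hφ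
  have hupp : ∀ n : ℤ, φ (upp (n : ZInv p)) = 0 := by
    intro n
    have hl0 : (0 : ℤ) < ℓ := by exact_mod_cast hl.pos
    obtain ⟨k, hk⟩ := Int.eq_ofNat_of_zero_le (Int.emod_nonneg n hl0.ne')
    have hcast : toF hpF (n : ZInv p) = toF hpF (k : ZInv p) := by
      rw [map_intCast, map_natCast, ← Int.cast_natCast (R := F) k, ← hk]
      exact intCast_eq_of_dvd (Int.dvd_self_sub_emod)
    rw [cocycle_oneParam_congr hφ upp_add (upp_mem hp hpM) rep_upp_congr' hU0 hcast,
      cocycle_oneParam_natCast hφ upp_add (upp_mem hp hpM), h1]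
    simp
  have hdet := congrArg (Int.cast : ℤ → F) h
  have hdet' := congrArg (Int.cast : ℤ → F) h'
  push_cast at hdet hdet'
  set n := d * b' - b * d' with hn
  have hmem := Gamma0_le_amalgam (mkZ_mem (p := p) h (dvd_mul_right _ _))
  have h2 : a * (M * c * n + d) - (a * n + b) * (M * c) = 1 := by linear_combination h
  have hmul : mkZ p a b (M * c) d h * upp (n : ZInv p) =
      mkZ p a (a * n + b) (M * c) (M * c * n + d) h2 := by
    rw [upp_intCast, mkZ_mul]
    apply mkZ_congr <;> ring
  have h3 : φ (mkZ p a (a * n + b) (M * c) (M * c * n + d) h2) = φ (mkZ p a b (M * c) d h) := by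
    rw [← hmul, hφ _ hmem _ (upp_mem hp hpM _), hupp, map_zero, add_zero]
  rw [← h3]
  refine cocycle_congr hp hpM hl hl5 hlp hlM hw hw0 hφ h2 h' ha ?_ hc ?_
  · rw [hn]; push_cast; rw [ha, hc] at *; linear_combination (b' : F) * hdet - (b : F) * hdet'
  · rw [hn]; push_cast; rw [ha, hc] at *; linear_combination (d' : F) * hdet - (d : F) * hdet'

/-- A cocycle which vanishes at `(1 1; 0 1)` is the coboundary of the sum of its values over the
nonzero vectors modulo `ℓ`. -/
theorem exists_eq_coboundary_of_upp_eq_zero (h1 : φ (upp 1) = 0) :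
    ∃ v : V F w, ∀ g ∈ Gamma0 p M, φ g = rep w hpF g v - v := by
  classical
  have : Fact ℓ.Prime := ⟨hl⟩
  have : NeZero ℓ := ⟨hl.ne_zero⟩
  have hMF : (M : ZMod ℓ) ≠ 0 := by rwa [Ne, ZMod.natCast_eq_zero_iff]
  have hex : ∀ v : ZMod ℓ × ZMod ℓ, ∃ u : V F w, v ≠ 0 → ∀ (a b c d : ℤ)
      (h : a * d - b * (M * c) = 1), (a : ZMod ℓ) = v.1 → (M * c : ZMod ℓ) = v.2 →
        φ (mkZ p a b (M * c) d h) = u := by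
    intro v
    by_cases hv : v = 0
    · exact ⟨0, fun h => absurd hv h⟩
    obtain ⟨a, b, c, d, h, ha, hc⟩ := exists_matrix_with_column hl hlM v hv
    refine ⟨φ (mkZ p a b (M * c) d h), fun _ a' b' c' d' h' ha' hc' => ?_⟩
    refine cocycle_eq_of_column_eq hp hpM hl hl5 hlp hlM hw hw0 hφ h1 h' h ?_ ?_
    · exact intCast_eq_of_zmod (ha'.trans ha.symm)
    · exact intCast_eq_of_zmod (mul_left_cancel₀ hMF (hc'.trans hc.symm))
  choose Φ hΦ using hex
  refine ⟨∑ v ∈ Finset.univ.erase 0, Φ v, fun g hg => ?_⟩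
  obtain ⟨a, b, c, d, h, rfl⟩ := mem_Gamma0_iff.1 hg
  set γ := mkZ p a b (M * c) d h
  have hdet := congrArg (Int.cast : ℤ → ZMod ℓ) h
  push_cast at hdet
  let e : ZMod ℓ × ZMod ℓ ≃ ZMod ℓ × ZMod ℓ :=
    { toFun := fun v => (a * v.1 + b * v.2, M * c * v.1 + d * v.2)
      invFun := fun v => (d * v.1 - b * v.2, -(M * c) * v.1 + a * v.2)
      left_inv := fun v => by
        ext
        · simp only; linear_combination v.1 * hdet
        · simp only; linear_combination v.2 * hdet
      right_inv := fun v => by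
        ext
        · simp only; linear_combination v.1 * hdet
        · simp only; linear_combination v.2 * hdet }
  have he0 : e 0 = 0 := by simp [e]
  -- The cocycle identity read on first columns. Summed over the `ℓ² - 1` nonzero vectors, which `γ`
  -- permutes, it gives `S = -φ γ + γ S`, since `ℓ² - 1 = -1` in `F`.
  have hstep : ∀ v ∈ (Finset.univ.erase 0 : Finset (ZMod ℓ × ZMod ℓ)),
      Φ (e v) = φ γ + rep w hpF γ (Φ v) := by
    intro v hv
    have hv0 := Finset.ne_of_mem_erase hv
    have hev0 : e v ≠ 0 := fun h => hv0 (e.injective (h.trans he0.symm))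
    obtain ⟨a', b', c', d', h', ha', hc'⟩ := exists_matrix_with_column hl hlM v hv0
    have h2 : (a * a' + b * (M * c')) * (M * c * b' + d * d') -
        (a * b' + b * d') * (M * (c * a' + d * c')) = 1 := by
      linear_combination (a' * d' - b' * (M * c')) * h + h'
    have hmul : γ * mkZ p a' b' (M * c') d' h' = mkZ p (a * a' + b * (M * c')) (a * b' + b * d')
        (M * (c * a' + d * c')) (M * c * b' + d * d') h2 := by
      rw [mkZ_mul]
      apply mkZ_congr <;> ring
    rw [← hΦ v hv0 a' b' c' d' h' ha' hc', ← hφ _ (Gamma0_le_amalgam hg) _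
      (Gamma0_le_amalgam (mkZ_mem h' (dvd_mul_right _ _))), hmul]
    refine (hΦ (e v) hev0 _ _ _ _ h2 ?_ ?_).symm
    · simp only [e, Equiv.coe_fn_mk]
      push_cast
      rw [← ha', ← hc']
    · simp only [e, Equiv.coe_fn_mk]
      push_cast
      rw [← ha', ← hc']
      ring
  have hsum : ∑ v ∈ Finset.univ.erase 0, Φ (e v) = ∑ v ∈ Finset.univ.erase 0, Φ v := by
    refine Finset.sum_equiv e (fun v => ?_) fun _ _ => rfl
    simp only [Finset.mem_erase, Finset.mem_univ, and_true]
    rw [← he0, e.injective.ne_iff, he0]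
  rw [Finset.sum_congr rfl hstep, Finset.sum_add_distrib, Finset.sum_const,
    Finset.card_erase_of_mem (Finset.mem_univ _), Finset.card_univ, Fintype.card_prod, ZMod.card,
    ← map_sum, ← Nat.cast_smul_eq_nsmul F, Nat.cast_sub (Nat.mul_pos hl.pos hl.pos)] at hsum
  push_cast at hsum
  rw [CharP.cast_eq_zero F ℓ, mul_zero, zero_sub, neg_one_smul] at hsum
  exact eq_sub_iff_add_eq.2 (neg_add_eq_iff_eq_add.1 hsum).symm

end Coboundary

/-! ### Passage from `Γ₀(M)` to `Γ₀(M)'`. -/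

section Coboundary

variable {F : Type u} [Field F] {ℓ w p M : ℕ} [CharP F ℓ] {hpF : IsUnit (p : F)}
  (hp : p.Prime) (hpM : ¬ p ∣ M) (hl : ℓ.Prime) (hl5 : 5 ≤ ℓ) (hlp : ℓ ≠ p) (hlM : ¬ ℓ ∣ M)
  (hw : w < ℓ) (hw0 : w ≠ 0)
  {φ : GL (Fin 2) (ZInv p) → V F w} (hφ : IsCocycleOn (rep w hpF) (amalgam p M) φ)

include hp hpM hl hl5 hlp hlM hw hw0 hφ

/-- The cocycle also vanishes at `upp (n / p)`, whose parameter agrees in `F` with that of an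
integral unipotent. Multiplication by such elements clears the denominator and moves any element of
`Γ₀(M)'` into `Γ₀(M)`. -/
theorem cocycle_eq_zero_on_Gamma0' (h0 : ∀ g ∈ Gamma0 p M, φ g = 0) :
    ∀ g ∈ Gamma0' p M, φ g = 0 := by
  obtain ⟨hU0, -⟩ := cocycle_char_eq_zero hp hpM hl hl5 hlp hlM hw hw0 hφ
  have hupp : ∀ n : ℤ, φ (upp ((n : ZInv p) * pInv p)) = 0 := by
    intro n
    have hcast : toF hpF ((n : ZInv p) * pInv p) = toF hpF ((n * p ^ (ℓ - 2) : ℤ) : ZInv p) := by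
      rw [map_mul, map_intCast, map_intCast, toF_pInv]
      have h1 := intCast_eq_of_dvd (F := F) (dvd_pow_sub_one hl hp hlp (dvd_refl (ℓ - 1)))
      rw [show ℓ - 1 = ℓ - 2 + 1 by omega, pow_succ] at h1
      push_cast at h1 ⊢
      rw [← eq_div_iff hpF.ne_zero] at h1
      rw [h1, one_div]
    rw [cocycle_oneParam_congr hφ upp_add (upp_mem hp hpM) rep_upp_congr' hU0 hcast]
    exact h0 _ (upp_int_mem _)
  have hcase : ∀ (a b c d : ℤ) (h : a * d - b * (M * c) = 1), ¬ (p : ℤ) ∣ a →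
      φ (mk2 (a : ZInv p) (b * pInv p) (p * (M * c : ℤ)) d (det_conj h)) = 0 := by
    intro a b c d h hpa
    have hcop : IsCoprime a (p : ℤ) :=
      ((Nat.prime_iff_prime_int.1 hp).coprime_iff_not_dvd.2 hpa).symm
    obtain ⟨s, t, hst⟩ := hcop
    set β := mk2 (a : ZInv p) (b * pInv p) (p * (M * c : ℤ)) d (det_conj h) with hβ
    have hβm : β ∈ amalgam p M := Gamma0'_le_amalgam (mem_Gamma0'_iff.2 ⟨a, b, c, d, h, rfl⟩)
    -- From `s a + t p = 1`, the new upper right entry is `b (1 - s a) / p = b t`, an integer.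
    have h2 : a * (M * c * (-(s * b)) + d) - (b * t) * (M * (p * c)) = 1 := by
      linear_combination h - M * c * b * hst
    have hmul : β * upp (((-(s * b) : ℤ) : ZInv p) * pInv p) =
        mkZ p a (b * t) (M * (p * c)) (M * c * (-(s * b)) + d) h2 := by
      have hst' := congrArg (Int.cast : ℤ → ZInv p) hst
      push_cast at hst'
      have hpp := mul_pInv p
      rw [hβ, upp, mkZ, mk2_mul]
      apply mk2_congr <;> push_cast
      · ring
      · linear_combination -(b : ZInv p) * pInv p * hst' + (t : ZInv p) * b * hpp
      · ring
      · linear_combination -(M : ZInv p) * c * s * b * hpp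
    have h3 := h0 _ (mkZ_mem h2 (dvd_mul_right _ _))
    rwa [← hmul, hφ _ hβm _ (upp_mem hp hpM _), hupp, map_zero, add_zero] at h3
  intro g hg
  obtain ⟨a, b, c, d, h, rfl⟩ := mem_Gamma0'_iff.1 hg
  by_cases hpa : (p : ℤ) ∣ a
  · have h2 : (a + M * c) * d - (b + d) * (M * c) = 1 := by linear_combination h
    have hpa' : ¬ (p : ℤ) ∣ a + M * c := by
      intro h3
      have h4 : (p : ℤ) ∣ M * c := (dvd_add_right hpa).1 h3
      exact (Nat.prime_iff_prime_int.1 hp).not_dvd_one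
        (h ▸ (hpa.mul_right d).sub (h4.mul_left b))
    have h3 := hcase _ _ _ _ h2 hpa'
    have hmul : upp (((1 : ℤ) : ZInv p) * pInv p) *
        mk2 (a : ZInv p) (b * pInv p) (p * (M * c : ℤ)) d (det_conj h) =
        mk2 ((a + M * c : ℤ) : ZInv p) ((b + d : ℤ) * pInv p) (p * (M * c : ℤ)) d
          (det_conj h2) := by
      rw [upp, mk2_mul]
      apply mk2_congr <;> push_cast
      · linear_combination (M : ZInv p) * c * mul_pInv p
      · ring
      · ring
      · ring
    rw [← hmul, hφ _ (upp_mem hp hpM _) _ (Gamma0'_le_amalgam hg), hupp, zero_add] at h3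
    exact (map_eq_zero_iff _ ((rep w hpF).apply_bijective _).1).1 h3
  · exact hcase a b c d h hpa

/-- A cocycle on the amalgam is a coboundary if the leading coefficient of its value at
`(1 1; 0 1)` vanishes. -/
theorem exists_eq_coboundary (h1 : topCoeff w (φ (upp 1)) = 0) :
    ∃ v : V F w, ∀ i, ∀ g ∈ factor p M i, φ g = rep w hpF g v - v := by
  obtain ⟨v₀, hv₀⟩ := exists_rep_upp_sub_eq hpF hw h1
  have hφ₁ := hφ.sub_coboundary v₀
  obtain ⟨v₁, hv₁⟩ := exists_eq_coboundary_of_upp_eq_zero hp hpM hl hl5 hlp hlM hw hw0 hφ₁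
    (by rw [hv₀, sub_self])
  have hφ₂ := hφ₁.sub_coboundary v₁
  have h0 : ∀ g ∈ Gamma0 p M, φ g - (rep w hpF g v₀ - v₀) - (rep w hpF g v₁ - v₁) = 0 :=
    fun g hg => by rw [hv₁ g hg, sub_self]
  have h0' := cocycle_eq_zero_on_Gamma0' hp hpM hl hl5 hlp hlM hw hw0 hφ₂ h0
  refine ⟨v₀ + v₁, ?_⟩
  have key : ∀ g, φ g - (rep w hpF g v₀ - v₀) - (rep w hpF g v₁ - v₁) = 0 →
      φ g = rep w hpF g (v₀ + v₁) - (v₀ + v₁) := by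
    intro g hg
    rw [sub_sub, sub_eq_zero] at hg
    rw [hg, map_add]
    abel
  rintro (_ | _) g hg
  · exact key g (h0' g hg)
  · exact key g (h0 g hg)

end Coboundary

/-! ### The exceptional cocycle for `ℓ = w + 3`, built from the Dickson invariant. -/

section SpecialCocycle

variable {F : Type u} [Field F] {ℓ : ℕ}

/-- The polynomial `X ^ (2 ℓ - 2) - X ^ (ℓ - 1) + 1`, whose homogenization takes the value `1` at
all nonzero vectors over the prime field. -/
def unitPoly (F : Type u) [Field F] (ℓ : ℕ) : F[X] := X ^ (2 * (ℓ - 1)) - X ^ (ℓ - 1) + 1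

theorem slash_unitPoly (γ : Matrix (Fin 2) (Fin 2) F) :
    slash (2 * (ℓ - 1)) γ (unitPoly F ℓ) =
      (C (γ 0 0) * X + C (γ 0 1)) ^ (2 * (ℓ - 1)) -
        (C (γ 0 0) * X + C (γ 0 1)) ^ (ℓ - 1) * (C (γ 1 0) * X + C (γ 1 1)) ^ (ℓ - 1) +
        (C (γ 1 0) * X + C (γ 1 1)) ^ (2 * (ℓ - 1)) := by
  have hmono : ∀ i ≤ 2 * (ℓ - 1), slash (2 * (ℓ - 1)) γ (X ^ i) =
      (C (γ 0 0) * X + C (γ 0 1)) ^ i * (C (γ 1 0) * X + C (γ 1 1)) ^ (2 * (ℓ - 1) - i) := by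
    intro i hi
    rw [slash_apply, Finset.sum_eq_single i]
    · simp
    · intro j _ hj
      simp [coeff_X_pow, hj]
    · intro h
      exact absurd (Finset.mem_range.2 (by omega)) h
  rw [unitPoly, map_add, map_sub, hmono _ le_rfl, hmono _ (by omega),
    ← pow_zero X, hmono 0 (Nat.zero_le _)]
  rw [show 2 * (ℓ - 1) - (ℓ - 1) = ℓ - 1 by omega]
  simp

end SpecialCocycle

section SpecialCocycle

variable {F : Type u} [Field F] {ℓ : ℕ}

/-- The matrices of determinant one with entries in the prime field. -/
def IsPrimeSL (ℓ : ℕ) (γ : Matrix (Fin 2) (Fin 2) F) : Prop :=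
  γ 0 0 * γ 1 1 - γ 0 1 * γ 1 0 = 1 ∧ ∀ i j, γ i j ^ ℓ = γ i j

/-- The polynomial `X ^ ℓ - X`. -/
def dicksonPoly (F : Type u) [Field F] (ℓ : ℕ) : F[X] := X ^ ℓ - X

theorem unit_value {u v : F} (hl : 1 < ℓ) (hu : u ^ ℓ = u) (hv : v ^ ℓ = v) (h : u ≠ 0 ∨ v ≠ 0) :
    u ^ (2 * (ℓ - 1)) - u ^ (ℓ - 1) * v ^ (ℓ - 1) + v ^ (2 * (ℓ - 1)) = 1 := by
  have hpow : ∀ {x : F}, x ^ ℓ = x → x ≠ 0 → x ^ (ℓ - 1) = 1 := fun {x} hx h0 => by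
    rw [← Nat.sub_add_cancel hl.le, pow_succ] at hx
    exact mul_right_cancel₀ h0 (by rw [hx, one_mul])
  have h0 : (0 : F) ^ (ℓ - 1) = 0 := zero_pow (by omega)
  rw [mul_comm 2, pow_mul, pow_mul]
  by_cases hu0 : u = 0
  · rw [hu0, h0, hpow hv (h.resolve_left (not_not.2 hu0))]; ring
  · by_cases hv0 : v = 0
    · rw [hv0, h0, hpow hu hu0]; ring
    · rw [hpow hu hu0, hpow hv hv0]; ring

theorem unitPoly_eq (hl : 2 ≤ ℓ) : unitPoly F ℓ = dicksonPoly F ℓ * X ^ (ℓ - 2) + 1 := by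
  obtain ⟨m, rfl⟩ : ∃ m, ℓ = m + 2 := ⟨ℓ - 2, by omega⟩
  rw [unitPoly, dicksonPoly, show m + 2 - 1 = m + 1 by omega, Nat.add_sub_cancel]
  ring

theorem dicksonPoly_natDegree (hl : 1 < ℓ) : (dicksonPoly F ℓ).natDegree = ℓ := by
  rw [dicksonPoly, natDegree_sub_eq_left_of_natDegree_lt] <;> simp [hl]

theorem dicksonPoly_monic (hl : 1 < ℓ) : (dicksonPoly F ℓ).Monic :=
  monic_X_pow_sub (by rw [degree_X]; exact_mod_cast hl)

/-- The value at `γ` of a cocycle with values in the polynomials of degree at most `ℓ - 3`. -/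
def specialPoly (ℓ : ℕ) (γ : Matrix (Fin 2) (Fin 2) F) : F[X] :=
  (slash (2 * (ℓ - 1)) γ (unitPoly F ℓ) - unitPoly F ℓ) /ₘ dicksonPoly F ℓ

theorem natDegree_unitPoly_le : (unitPoly F ℓ).natDegree ≤ 2 * (ℓ - 1) := by
  refine (natDegree_add_le _ _).trans (max_le ((natDegree_sub_le _ _).trans (max_le ?_ ?_)) ?_)
  · simp
  · simp; omega
  · simp

theorem coeff_unitPoly (hl : 1 < ℓ) : (unitPoly F ℓ).coeff (2 * (ℓ - 1)) = 1 := by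
  have h1 : 2 * (ℓ - 1) ≠ ℓ - 1 := by omega
  have h2 : 2 * (ℓ - 1) ≠ 0 := by omega
  simp [unitPoly, coeff_X_pow, coeff_one, h1, h2]

theorem coeff_slash_unitPoly {γ : Matrix (Fin 2) (Fin 2) F} :
    (slash (2 * (ℓ - 1)) γ (unitPoly F ℓ)).coeff (2 * (ℓ - 1)) =
      γ 0 0 ^ (2 * (ℓ - 1)) - γ 0 0 ^ (ℓ - 1) * γ 1 0 ^ (ℓ - 1) + γ 1 0 ^ (2 * (ℓ - 1)) := by
  have hdeg : ∀ (a b : F) (n : ℕ), ((C a * X + C b) ^ n).natDegree ≤ n := fun a b n =>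
    (natDegree_pow_le_of_le n (natDegree_linear_le a b)).trans (by rw [mul_one])
  rw [slash_unitPoly, coeff_add, coeff_sub, coeff_linear_pow, coeff_linear_pow, two_mul,
    coeff_mul_add_eq_of_natDegree_le (hdeg _ _ _) (hdeg _ _ _), coeff_linear_pow, coeff_linear_pow]

variable [CharP F ℓ]

/-- The form `E` equals `1` at every nonzero vector over `𝔽_ℓ` and `γ` permutes these, so `E|γ - E`
vanishes at all roots of `X ^ ℓ - X`. -/
theorem IsPrimeSL.dvd {γ : Matrix (Fin 2) (Fin 2) F} (hγ : IsPrimeSL ℓ γ) (hl : ℓ.Prime) :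
    dicksonPoly F ℓ ∣ slash (2 * (ℓ - 1)) γ (unitPoly F ℓ) - unitPoly F ℓ := by
  have : Fact ℓ.Prime := ⟨hl⟩
  have hmonic := dicksonPoly_monic (F := F) hl.one_lt
  have hfix : ∀ i : ℕ, (i : F) ^ ℓ = i := fun i => by
    have := map_natCast (frobenius F ℓ) i
    rwa [frobenius_def] at this
  rw [← modByMonic_eq_zero_iff_dvd hmonic]
  refine eq_zero_of_natDegree_lt_card_of_eval_eq_zero _ (f := fun i : Fin ℓ => ((i : ℕ) : F))
    ?_ ?_ ?_
  · intro i j hij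
    rw [CharP.natCast_eq_natCast F ℓ] at hij
    exact Fin.ext (Nat.ModEq.eq_of_lt_of_lt hij i.2 j.2)
  · intro i
    have hroot : (dicksonPoly F ℓ).eval ((i : ℕ) : F) = 0 := by simp [dicksonPoly, hfix]
    have hmod : ∀ A : F[X], (A %ₘ dicksonPoly F ℓ).eval ((i : ℕ) : F) = A.eval ((i : ℕ) : F) :=
      fun A => by
        conv_rhs => rw [← modByMonic_add_div A (dicksonPoly F ℓ), eval_add, eval_mul, hroot]
        rw [zero_mul, add_zero]
    rw [hmod, eval_sub, slash_unitPoly]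
    have h1 : (unitPoly F ℓ).eval ((i : ℕ) : F) = 1 := by
      rw [unitPoly_eq hl.two_le, eval_add, eval_mul, hroot]; simp
    rw [h1, sub_eq_zero]
    simp only [eval_add, eval_sub, eval_mul, eval_pow, eval_C, eval_X]
    have hlin : ∀ j, (γ j 0 * ((i : ℕ) : F) + γ j 1) ^ ℓ = γ j 0 * ((i : ℕ) : F) + γ j 1 :=
      fun j => by rw [add_pow_char, mul_pow, hγ.2, hγ.2, hfix]
    refine unit_value hl.one_lt (hlin 0) (hlin 1) ?_
    by_contra! h0
    have hdet := hγ.1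
    have : (1 : F) = 0 := by
      linear_combination -hdet + (γ 0 0) * h0.2 - γ 1 0 * h0.1
    exact one_ne_zero this
  · rw [Fintype.card_fin]
    refine (natDegree_modByMonic_lt _ hmonic fun h => ?_).trans_eq (dicksonPoly_natDegree hl.one_lt)
    have := dicksonPoly_natDegree (F := F) hl.one_lt
    rw [h, natDegree_one] at this
    exact hl.ne_zero this.symm

theorem IsPrimeSL.mul_specialPoly {γ : Matrix (Fin 2) (Fin 2) F} (hγ : IsPrimeSL ℓ γ)
    (hl : ℓ.Prime) : dicksonPoly F ℓ * specialPoly ℓ γ =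
      slash (2 * (ℓ - 1)) γ (unitPoly F ℓ) - unitPoly F ℓ := by
    have h := modByMonic_add_div (slash (2 * (ℓ - 1)) γ (unitPoly F ℓ) - unitPoly F ℓ)
      (dicksonPoly F ℓ)
    rwa [(modByMonic_eq_zero_iff_dvd (dicksonPoly_monic hl.one_lt)).2 (hγ.dvd hl), zero_add] at h

omit [CharP F ℓ] in
theorem IsPrimeSL.specialPoly_mem {γ : Matrix (Fin 2) (Fin 2) F} (hγ : IsPrimeSL ℓ γ)
    (hl : ℓ.Prime) {w : ℕ} (hlw : ℓ = w + 3) : specialPoly ℓ γ ∈ V F w := by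
  have hlt : (slash (2 * (ℓ - 1)) γ (unitPoly F ℓ) - unitPoly F ℓ).natDegree ≤ 2 * (ℓ - 1) - 1 := by
    have hle : (slash (2 * (ℓ - 1)) γ (unitPoly F ℓ) - unitPoly F ℓ).natDegree ≤ 2 * (ℓ - 1) :=
      (natDegree_sub_le _ _).trans (max_le (mem_V_iff.1 (slash_mem _ _ _)) natDegree_unitPoly_le)
    -- The top coefficient is the value at infinity and cancels as well. The quotient therefore has
    -- degree at most `2 (ℓ - 1) - 1 - ℓ = ℓ - 3 = w`.
    refine Nat.le_sub_one_of_lt (lt_of_le_of_ne hle fun h => ?_)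
    have hcoeff : (slash (2 * (ℓ - 1)) γ (unitPoly F ℓ) - unitPoly F ℓ).coeff (2 * (ℓ - 1)) = 0 := by
      rw [coeff_sub, coeff_unitPoly hl.one_lt, coeff_slash_unitPoly,
        unit_value hl.one_lt (hγ.2 0 0) (hγ.2 1 0), sub_self]
      by_contra! h0
      have hdet := hγ.1
      rw [h0.1, h0.2] at hdet
      simp at hdet
    have h2 := leadingCoeff_eq_zero.1 ((congrArg _ h).trans hcoeff)
    rw [h2, natDegree_zero] at h
    have := hl.one_lt
    omega
  rw [mem_V_iff, specialPoly, natDegree_divByMonic _ (dicksonPoly_monic hl.one_lt),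
    dicksonPoly_natDegree hl.one_lt]
  omega

/-- As a form of degree `ℓ + 1` this is the determinant of a vector and its Frobenius twist; a
matrix over the prime field multiplies it by its determinant `1`. -/
theorem IsPrimeSL.slash_dicksonPoly {γ : Matrix (Fin 2) (Fin 2) F} (hγ : IsPrimeSL ℓ γ)
    (hl : ℓ.Prime) : slash (ℓ + 1) γ (dicksonPoly F ℓ) = dicksonPoly F ℓ := by
  have : Fact ℓ.Prime := ⟨hl⟩
  have hmono : ∀ i ≤ ℓ + 1, slash (ℓ + 1) γ (X ^ i) =
      (C (γ 0 0) * X + C (γ 0 1)) ^ i * (C (γ 1 0) * X + C (γ 1 1)) ^ (ℓ + 1 - i) := by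
    intro i hi
    rw [slash_apply, Finset.sum_eq_single i]
    · simp
    · intro j _ hj
      simp [coeff_X_pow, hj]
    · intro h
      exact absurd (Finset.mem_range.2 (by omega)) h
  have hlin : ∀ j, (C (γ j 0) * X + C (γ j 1)) ^ ℓ = C (γ j 0) * X ^ ℓ + C (γ j 1) :=
    fun j => by rw [add_pow_char, mul_pow, ← C_pow, ← C_pow, hγ.2, hγ.2]
  have h1 := hmono 1 (by omega)
  rw [pow_one] at h1
  have hdet := congrArg (C : F → F[X]) hγ.1
  simp only [map_sub, map_mul, map_one] at hdet
  rw [dicksonPoly, map_sub, hmono ℓ (by omega), h1, Nat.add_sub_cancel_left, Nat.add_sub_cancel,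
    hlin, hlin]
  linear_combination (X ^ ℓ - X) * hdet

/-- `E|γ - E` is a coboundary in weight `2 (ℓ - 1) = (ℓ + 1) + w`. Dividing by the invariant form of
weight `ℓ + 1` preserves the cocycle identity, though not triviality. -/
theorem specialPoly_mul {γ δ : Matrix (Fin 2) (Fin 2) F} (hγ : IsPrimeSL ℓ γ)
    (hδ : IsPrimeSL ℓ δ) (hγδ : IsPrimeSL ℓ (γ * δ)) (hl : ℓ.Prime) {w : ℕ} (hlw : ℓ = w + 3) :
    specialPoly ℓ (γ * δ) = specialPoly ℓ δ + slash w δ (specialPoly ℓ γ) := by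
  have h0 := (dicksonPoly_monic (F := F) hl.one_lt).ne_zero
  refine mul_left_cancel₀ h0 ?_
  have hmul : slash (2 * (ℓ - 1)) δ (dicksonPoly F ℓ * specialPoly ℓ γ) =
      dicksonPoly F ℓ * slash w δ (specialPoly ℓ γ) := by
    rw [show 2 * (ℓ - 1) = (ℓ + 1) + w by omega, slash,
      substHom_mul _ _ ((dicksonPoly_natDegree hl.one_lt).le.trans (Nat.le_succ _))
        (mem_V_iff.1 (hγ.specialPoly_mem hl hlw))]
    change slash (ℓ + 1) δ _ * _ = _
    rw [hδ.slash_dicksonPoly hl]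
    rfl
  rw [hγδ.mul_specialPoly hl, mul_add, hδ.mul_specialPoly hl, ← hmul, hγ.mul_specialPoly hl,
    slash_mul, map_sub]
  ring

/-- Writing `E = Δ X ^ (ℓ - 2) + 1` with `Δ` translation invariant, the value is `(X - 1) ^ (w + 1)
- X ^ (w + 1)`, with leading coefficient `-(w + 1) = 2` because `w + 3 = 0` in `F`. -/
theorem coeff_specialPoly_upper (hl : ℓ.Prime) {w : ℕ} (hlw : ℓ = w + 3)
    (h : IsPrimeSL ℓ !![(1 : F), -1; 0, 1]) :
    (specialPoly ℓ !![(1 : F), -1; 0, 1]).coeff w = 2 := by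
  have : Fact ℓ.Prime := ⟨hl⟩
  have h0 := (dicksonPoly_monic (F := F) hl.one_lt).ne_zero
  have hΔ : (dicksonPoly F ℓ).comp (X + C (-1)) = dicksonPoly F ℓ := by
    rw [dicksonPoly, sub_comp, pow_comp, X_comp, add_pow_char, ← C_pow]
    have : (-1 : F) ^ ℓ = -1 := by
      have := map_neg (frobenius F ℓ) 1
      rwa [map_one, frobenius_def] at this
    rw [this]
    ring
  have heq : specialPoly ℓ !![(1 : F), -1; 0, 1] = (X + C (-1)) ^ (w + 1) - X ^ (w + 1) := by
    refine mul_left_cancel₀ h0 ?_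
    rw [h.mul_specialPoly hl, slash_upper (mem_V_iff.2 natDegree_unitPoly_le),
      unitPoly_eq hl.two_le, add_comp, mul_comp, hΔ, show ℓ - 2 = w + 1 by omega]
    simp
    ring
  rw [heq, coeff_sub, coeff_X_add_C_pow, coeff_X_pow, Nat.add_sub_cancel_left, Nat.choose_succ_self_right]
  have h3 : ((w + 3 : ℕ) : F) = 0 := by rw [← hlw]; exact CharP.cast_eq_zero F ℓ
  push_cast at h3 ⊢
  simp
  linear_combination -h3

end SpecialCocycle

/-! ### The exceptional cocycle on the amalgam. -/

section SpecialCocycle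

variable {F : Type u} [Field F] {ℓ w p M : ℕ} [CharP F ℓ] (hpF : IsUnit (p : F))

/-- The matrices of determinant one, as a subgroup of `GL₂`. -/
def detOne (R : Type*) [CommRing R] : Subgroup (GL (Fin 2) R) where
  carrier := {g | ∃ a b c d, ∃ h : a * d - b * c = 1, g = mk2 a b c d h}
  mul_mem' := by
    rintro _ _ ⟨a, b, c, d, h, rfl⟩ ⟨a', b', c', d', h', rfl⟩
    exact ⟨_, _, _, _, _, mk2_mul h h'⟩
  one_mem' := ⟨_, _, _, _, _, mk2_one.symm⟩
  inv_mem' := by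
    rintro _ ⟨a, b, c, d, h, rfl⟩
    exact ⟨_, _, _, _, _, mk2_inv h⟩

theorem amalgam_le_detOne : amalgam p M ≤ detOne (ZInv p) := by
  refine iSup_le ?_
  rintro (_ | _) g hg
  · obtain ⟨a, b, c, d, h, rfl⟩ := mem_Gamma0'_iff.1 hg
    exact ⟨_, _, _, _, _, rfl⟩
  · obtain ⟨a, b, c, d, h, rfl⟩ := mem_Gamma0_iff.1 hg
    exact ⟨_, _, _, _, _, rfl⟩

/-- There is only one ring homomorphism from `ℤ[1/p]` to `F`, so composing with Frobenius changes
nothing. -/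
theorem toF_pow_char (hl : ℓ.Prime) (x : ZInv p) : toF hpF x ^ ℓ = toF hpF x := by
  have : Fact ℓ.Prime := ⟨hl⟩
  have h : (frobenius F ℓ).comp (toF hpF) = toF hpF :=
    IsLocalization.ringHom_ext (Submonoid.powers (p : ℤ)) (RingHom.ext_int _ _)
  exact congrArg (fun f : ZInv p →+* F => f x) h

/-- The matrix over `F` by which `g` acts on polynomials. -/
def actionMatrix (g : GL (Fin 2) (ZInv p)) : Matrix (Fin 2) (Fin 2) F :=
  ((Matrix.GeneralLinearGroup.map (toF hpF) g)⁻¹ : GL (Fin 2) F)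

theorem actionMatrix_mul (g h : GL (Fin 2) (ZInv p)) :
    actionMatrix hpF (g * h) = actionMatrix hpF h * actionMatrix hpF g := by
  simp [actionMatrix, mul_inv_rev]

theorem actionMatrix_mk2 {a b c d : ZInv p} (h : a * d - b * c = 1) :
    actionMatrix hpF (mk2 a b c d h) =
      !![toF hpF d, -toF hpF b; -toF hpF c, toF hpF a] := by
  rw [actionMatrix, ← map_inv, mk2_inv]
  ext i j
  fin_cases i <;> fin_cases j <;> simp [mk2]

theorem rep_apply (g : GL (Fin 2) (ZInv p)) (P : V F w) :
    (rep w hpF g P : F[X]) = slash w (actionMatrix hpF g) P := rfl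

theorem isPrimeSL_actionMatrix (hl : ℓ.Prime) {g : GL (Fin 2) (ZInv p)}
    (hg : g ∈ detOne (ZInv p)) : IsPrimeSL ℓ (actionMatrix hpF g) := by
  obtain ⟨a, b, c, d, h, rfl⟩ := hg
  rw [actionMatrix_mk2]
  refine ⟨?_, fun i j => ?_⟩
  · have := congrArg (toF hpF) h
    rw [map_sub, map_mul, map_mul, map_one] at this
    simp only [Matrix.of_apply, Matrix.cons_val', Matrix.cons_val_zero, Matrix.cons_val_fin_one,
      Matrix.cons_val_one]
    linear_combination this
  · have := toF_pow_char (p := p) (ℓ := ℓ) hpF hl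
    fin_cases i <;> fin_cases j
    · exact this d
    · change (-toF hpF b) ^ ℓ = -toF hpF b
      rw [← map_neg]; exact this _
    · change (-toF hpF c) ^ ℓ = -toF hpF c
      rw [← map_neg]; exact this _
    · exact this a

open Classical in
/-- The exceptional cocycle, for `ℓ = w + 3`. -/
def specialCocycle (ℓ w : ℕ) (g : GL (Fin 2) (ZInv p)) : V F w :=
  if h : specialPoly ℓ (actionMatrix hpF g) ∈ V F w then ⟨_, h⟩ else 0

theorem specialCocycle_coe (hl : ℓ.Prime) (hlw : ℓ = w + 3) {g : GL (Fin 2) (ZInv p)}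
    (hg : g ∈ detOne (ZInv p)) :
    (specialCocycle hpF ℓ w g : F[X]) = specialPoly ℓ (actionMatrix hpF g) := by
  rw [specialCocycle, dif_pos ((isPrimeSL_actionMatrix hpF hl hg).specialPoly_mem hl hlw)]

theorem isCocycleOn_specialCocycle (hl : ℓ.Prime) (hlw : ℓ = w + 3) :
    IsCocycleOn (rep w hpF) (amalgam p M) (specialCocycle hpF ℓ w) := by
  intro g hg h hh
  have hg' := amalgam_le_detOne hg
  have hh' := amalgam_le_detOne hh
  refine Subtype.ext ?_
  rw [Submodule.coe_add, rep_apply, specialCocycle_coe hpF hl hlw hg',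
    specialCocycle_coe hpF hl hlw hh', specialCocycle_coe hpF hl hlw (mul_mem hg' hh'),
    actionMatrix_mul]
  refine specialPoly_mul (isPrimeSL_actionMatrix hpF hl hh') (isPrimeSL_actionMatrix hpF hl hg')
    ?_ hl hlw
  rw [← actionMatrix_mul]
  exact isPrimeSL_actionMatrix hpF hl (mul_mem hg' hh')

theorem topCoeff_specialCocycle (hl : ℓ.Prime) (hlw : ℓ = w + 3) :
    topCoeff w (specialCocycle hpF ℓ w (upp 1)) = 2 := by
  have hmem : (upp 1 : GL (Fin 2) (ZInv p)) ∈ detOne (ZInv p) := ⟨_, _, _, _, _, rfl⟩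
  have hmat : actionMatrix hpF (upp (1 : ZInv p)) = !![1, -1; 0, 1] := by
    rw [upp, actionMatrix_mk2]
    simp
  rw [topCoeff_apply, specialCocycle_coe hpF hl hlw hmem, hmat]
  exact coeff_specialPoly_upper hl hlw (hmat ▸ isPrimeSL_actionMatrix hpF hl hmem)

end SpecialCocycle

/-! ### Cohomology classes of cocycles defined on the whole group. -/

section Cohomology

open groupCohomology

variable {F : Type u} [Field F] {G : Type} [Group G] {W : Type u} [AddCommGroup W] [Module F W]
  {ρ : Representation F G W} {Γ Δ : Subgroup G}

/-- The cocycles on a subgroup, as a subspace of the space of all maps on the group. -/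
def cocyclesOn (ρ : Representation F G W) (Γ : Subgroup G) : Submodule F (G → W) where
  carrier := {f | IsCocycleOn ρ Γ f}
  add_mem' {f f'} hf hf' g hg h hh := by
    rw [Pi.add_apply, hf g hg h hh, hf' g hg h hh, Pi.add_apply, Pi.add_apply, map_add]
    abel
  zero_mem' g hg h hh := by simp
  smul_mem' c f hf g hg h hh := by
    rw [Pi.smul_apply, hf g hg h hh, smul_add, Pi.smul_apply, Pi.smul_apply, map_smul]

/-- The restriction of a cocycle to the subgroup. -/
def toCocycles (ρ : Representation F G W) (Γ : Subgroup G) :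
    cocyclesOn ρ Γ →ₗ[F] cocycles₁ (resRep ρ Γ) where
  toFun f := ⟨fun g => f.1 g.down, (mem_cocycles₁_iff _).2 fun g h => by
    rw [add_comm]
    exact f.2 g.down g.down.2 h.down h.down.2⟩
  map_add' _ _ := rfl
  map_smul' _ _ := rfl

/-- The cohomology class of a cocycle. -/
def classOf (ρ : Representation F G W) (Γ : Subgroup G) : cocyclesOn ρ Γ →ₗ[F] H1 ρ Γ :=
  (H1π (resRep ρ Γ)).hom.comp (toCocycles ρ Γ)

theorem classOf_surjective : Function.Surjective (classOf ρ Γ) := by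
  classical
  intro x
  induction x using H1_induction_on with
  | h f =>
    have hf := (mem_cocycles₁_iff _).1 f.2
    refine ⟨⟨fun g => if h : g ∈ Γ then f ⟨⟨g, h⟩⟩ else 0, fun g hg h hh => ?_⟩, ?_⟩
    · beta_reduce
      rw [dif_pos hg, dif_pos hh, dif_pos (mul_mem hg hh), add_comm]
      exact hf ⟨⟨g, hg⟩⟩ ⟨⟨h, hh⟩⟩
    · refine congrArg (H1π (resRep ρ Γ)) (cocycles₁_ext fun g => ?_)
      exact dif_pos g.down.2

theorem classOf_eq_zero_iff {f : cocyclesOn ρ Γ} :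
    classOf ρ Γ f = 0 ↔ ∃ v, ∀ g ∈ Γ, f.1 g = ρ g v - v := by
  refine (H1π_eq_zero_iff _).trans ⟨?_, ?_⟩
  · rintro ⟨v, hv⟩
    exact ⟨v, fun g hg => (congrFun hv ⟨⟨g, hg⟩⟩).symm⟩
  · rintro ⟨v, hv⟩
    exact ⟨v, funext fun g => (hv g.down g.down.2).symm⟩

theorem restriction_classOf (h : Δ ≤ Γ) (f : cocyclesOn ρ Γ) :
    restriction ρ h (classOf ρ Γ f) = classOf ρ Δ ⟨f.1, f.2.mono h⟩ :=
  H1π_comp_map_apply (A := resRep ρ Γ) (B := resRep ρ Δ) (inclusion h)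
    (Rep.ofHom ⟨LinearMap.id, fun _ => rfl⟩) (toCocycles ρ Γ f)

end Cohomology

theorem cocyclesOn_mono {G : Type} {W F : Type u} [Group G] [Field F] [AddCommGroup W] [Module F W]
    (ρ : Representation F G W) {Δ Γ : Subgroup G} (h : Δ ≤ Γ) : cocyclesOn ρ Γ ≤ cocyclesOn ρ Δ :=
  fun _ hf => IsCocycleOn.mono hf h

/-! ### The kernel of `alpha` in terms of cocycles on the amalgam. -/

section Kernel

variable {F : Type u} [Field F] {ℓ w p M : ℕ} (hpF : IsUnit (p : F))

/-- The pair of cohomology classes given by a cocycle on the amalgam, with opposite signs on the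
two factors. -/
def kernelClass (w M : ℕ) : cocyclesOn (rep w hpF) (amalgam p M) →ₗ[F]
    H1 (rep w hpF) (Gamma0 p M) × H1 (rep w hpF) (Gamma0' p M) :=
  ((classOf (rep w hpF) (Gamma0 p M)).comp
    (Submodule.inclusion (cocyclesOn_mono _ Gamma0_le_amalgam))).prod
    (-(classOf (rep w hpF) (Gamma0' p M)).comp
      (Submodule.inclusion (cocyclesOn_mono _ Gamma0'_le_amalgam)))

theorem kernelClass_mem (φ : cocyclesOn (rep w hpF) (amalgam p M)) :
    kernelClass hpF w M φ ∈ LinearMap.ker (alpha w M hpF) := by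
  rw [LinearMap.mem_ker]
  change restriction _ _ (classOf _ _ _) + restriction _ _ (-classOf _ _ _) = 0
  rw [map_neg, restriction_classOf, restriction_classOf]
  exact add_neg_cancel _

theorem exists_eq_kernelClass (hp : p.Prime) (hpM : ¬ p ∣ M)
    {x : H1 (rep w hpF) (Gamma0 p M) × H1 (rep w hpF) (Gamma0' p M)}
    (hx : x ∈ LinearMap.ker (alpha w M hpF)) : ∃ φ, kernelClass hpF w M φ = x := by
  have : Fact p.Prime := ⟨hp⟩
  obtain ⟨x, y⟩ := x
  obtain ⟨f, rfl⟩ := classOf_surjective x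
  obtain ⟨g, rfl⟩ := classOf_surjective y
  rw [LinearMap.mem_ker] at hx
  change restriction _ _ (classOf _ _ f) + restriction _ _ (classOf _ _ g) = 0 at hx
  rw [restriction_classOf, restriction_classOf, ← map_add, classOf_eq_zero_iff] at hx
  obtain ⟨v, hv⟩ := hx
  -- On `Γ₀(Mp)` the sum `f + g` is the coboundary of `v`, so `-g` plus that coboundary agrees there
  -- with `f`.
  have hg' : IsCocycleOn (rep w hpF) (Gamma0' p M) fun k => -g.1 k - (rep w hpF k (-v) - -v) :=
    (show IsCocycleOn _ _ (-g.1) from (-g).2).sub_coboundary (-v)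
  obtain ⟨φ, hφ, hφf⟩ := exists_cocycle_extension (Gamma0_mul_le_factor p M) (rep w hpF)
    (amalgamHom_Gamma0_injective hp hpM)
    (fun i => if i then f.1 else fun k => -g.1 k - (rep w hpF k (-v) - -v))
    (by rintro (_ | _); exacts [hg', f.2])
    (by
      rintro (_ | _) k hk
      · have := hv k hk
        change f.1 k + g.1 k = _ at this
        change -g.1 k - (rep w hpF k (-v) - -v) = f.1 k
        rw [eq_sub_of_add_eq this, map_neg]
        abel
      · rfl)
  refine ⟨⟨φ, hφ⟩, Prod.ext ?_ ?_⟩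
  · change classOf _ _ _ = classOf _ _ f
    rw [← sub_eq_zero, ← map_sub, classOf_eq_zero_iff]
    refine ⟨0, fun k hk => ?_⟩
    have : φ k = f.1 k := hφf true k hk
    change φ k - f.1 k = _
    rw [this]
    simp
  · change -classOf _ _ _ = classOf _ _ g
    rw [← sub_eq_zero, ← map_neg, ← map_sub, classOf_eq_zero_iff]
    refine ⟨-v, fun k hk => ?_⟩
    have : φ k = -g.1 k - (rep w hpF k (-v) - -v) := hφf false k hk
    change -φ k - g.1 k = _
    rw [this]
    abel

variable [CharP F ℓ]

theorem kernelClass_eq_zero (hp : p.Prime) (hpM : ¬ p ∣ M) (hl : ℓ.Prime) (hl5 : 5 ≤ ℓ)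
    (hlp : ℓ ≠ p) (hlM : ¬ ℓ ∣ M) (hw : w < ℓ) (hw0 : w ≠ 0)
    {φ : cocyclesOn (rep w hpF) (amalgam p M)} (h : topCoeff w (φ.1 (upp 1)) = 0) :
    kernelClass hpF w M φ = 0 := by
  obtain ⟨v, hv⟩ := exists_eq_coboundary hp hpM hl hl5 hlp hlM hw hw0 φ.2 h
  refine Prod.ext ?_ ?_
  · exact classOf_eq_zero_iff.2 ⟨v, hv true⟩
  · exact neg_eq_zero.2 (classOf_eq_zero_iff.2 ⟨v, hv false⟩)

-- The leading coefficient is invariant under `upp 1`, so it vanishes on every coboundary value at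
-- `upp 1`; this makes it an invariant of the class.
omit [CharP F ℓ] in
theorem topCoeff_eq_zero_of_kernelClass_eq_zero {φ : cocyclesOn (rep w hpF) (amalgam p M)}
    (h : kernelClass hpF w M φ = 0) : topCoeff w (φ.1 (upp 1)) = 0 := by
  have h1 : classOf _ _ _ = 0 := congrArg Prod.fst h
  obtain ⟨v, hv⟩ := classOf_eq_zero_iff.1 h1
  have hmem : (upp 1 : GL (Fin 2) (ZInv p)) ∈ Gamma0 p M := by
    have := upp_int_mem (p := p) (M := M) 1
    rwa [Int.cast_one] at this
  have h2 : φ.1 (upp 1) = _ := hv _ hmem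
  rw [h2, map_sub, topCoeff_rep_upp, sub_self]

end Kernel

end IharaFull

end

/-! ### The dichotomy between `ℓ ≠ w + 3` and `ℓ = w + 3`. -/

theorem propositionP3 {F : Type*} [Field F] (ℓ w p M : ℕ) [CharP F ℓ]
    (hp : p.Prime) (hpM : ¬ p ∣ M) (hw : Even w) (hw2 : 2 ≤ w)
    (hℓw : w < ℓ) (hℓ : ¬ ℓ ∣ 6 * p * M) :
    (ℓ ≠ w + 3 →
      Function.Injective (IharaFull.alpha (F := F) w M (IharaFull.isUnit_of_not_dvd ℓ hℓ))) ∧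
    (ℓ = w + 3 →
      Module.finrank F (LinearMap.ker
        (IharaFull.alpha (F := F) w M (IharaFull.isUnit_of_not_dvd ℓ hℓ))) = 1) := by
  have hl : ℓ.Prime := (CharP.char_is_prime_or_zero F ℓ).resolve_right (by omega)
  have hlp : ℓ ≠ p := fun h => hℓ (h ▸ (dvd_mul_left ℓ 6).mul_right M)
  have hlM : ¬ ℓ ∣ M := fun h => hℓ (h.mul_left _)
  have hl5 : 5 ≤ ℓ := by
    have h3 : ℓ ≠ 3 := fun h => hℓ (h ▸ ((by norm_num : 3 ∣ 6).mul_right p).mul_right M)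
    have h4 : ℓ ≠ 4 := fun h => by rw [h] at hl; norm_num at hl
    omega
  have hw0 : w ≠ 0 := by omega
  set hpF := IharaFull.isUnit_of_not_dvd (F := F) ℓ hℓ
  have hzero := fun φ => IharaFull.kernelClass_eq_zero (M := M) hpF hp hpM hl hl5 hlp hlM hℓw hw0
    (φ := φ)
  refine ⟨fun hne => ?_, fun heq => ?_⟩
  · rw [← LinearMap.ker_eq_bot, eq_bot_iff]
    intro x hx
    obtain ⟨φ, rfl⟩ := IharaFull.exists_eq_kernelClass hpF hp hpM hx
    exact hzero φ (IharaFull.topCoeff_eq_zero hp hpM hl hl5 hlp hlM hℓw hw0 φ.2 hne)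
  · let ψ : IharaFull.cocyclesOn (IharaFull.rep w hpF) (IharaFull.amalgam p M) :=
      ⟨_, IharaFull.isCocycleOn_specialCocycle hpF hl heq⟩
    have hψ : IharaFull.topCoeff w (ψ.1 (IharaFull.upp 1)) = 2 :=
      IharaFull.topCoeff_specialCocycle hpF hl heq
    have h2 : (2 : F) ≠ 0 := by
      intro h2
      have : ((2 : ℕ) : F) = 0 := by exact_mod_cast h2
      rw [CharP.cast_eq_zero_iff F ℓ] at this
      have := Nat.le_of_dvd (by norm_num) this
      omega
    refine finrank_eq_one_iff'.2 ⟨⟨_, IharaFull.kernelClass_mem hpF ψ⟩, fun h => ?_, ?_⟩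
    · have h3 := IharaFull.topCoeff_eq_zero_of_kernelClass_eq_zero hpF (congrArg Subtype.val h)
      exact h2 (hψ.symm.trans h3)
    · rintro ⟨x, hx⟩
      obtain ⟨φ, rfl⟩ := IharaFull.exists_eq_kernelClass hpF hp hpM hx
      -- The exceptional cocycle has invariant `2`, so `c • ψ - φ` has invariant zero and hence
      -- trivial class.
      set c := IharaFull.topCoeff w (φ.1 (IharaFull.upp 1)) / 2 with hc
      refine ⟨c, Subtype.ext ?_⟩
      have h3 := hzero (c • ψ - φ) (by
        change IharaFull.topCoeff w (c • ψ.1 (IharaFull.upp 1) - φ.1 (IharaFull.upp 1)) = 0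
        rw [map_sub, map_smul, hψ, hc, smul_eq_mul, div_mul_cancel₀ _ h2, sub_self])
      have h4 := (LinearMap.map_sub (IharaFull.kernelClass hpF w M) (c • ψ) φ).symm.trans h3
      exact ((IharaFull.kernelClass hpF w M).map_smul c ψ).symm.trans (sub_eq_zero.1 h4)
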